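/- **Notation.** Let $\tau,r\in\mathbb C$ with $\operatorname{Im}\tau>0$, $r\neq0$, let $x^{c}=e^{-\pi i c/(\tau r)}$ and $p=e^{2\pi i\tau}$. Put $$\vartheta_1(u|\tau)=2p^{1/8}(p;p)_\infty\sin(\pi u)\prod_{m\ge1}(1-2p^m\cos 2\pi u+p^{2m}),$$ where $p^{1/8}=e^{\pi i\tau/4}$, $\vartheta_0(u|\tau)=-ie^{\pi i(u+\tau/4)}\vartheta_1(u+\frac\tau2|\tau)$, $\vartheta_3(u|\tau)=e^{\pi i(u+\tau/4)}\vartheta_1(u+\frac{\tau+1}2|\tau)$, and $[u]=C\,\vartheta_1(u/r|\tau)$ with $C=x^{-r/4}e^{-\pi i/4}\tau^{1/2}$. For each integer $a$ fix a square root $\sqrt{[a]}$ of $[a]$; square roots of products and quotients of the numbers $[a]$ are formed from these. Let $k\ge1$ be an integer with $[1],\dots,[k]\ne0$ and put $$(a,b)_k=\left(\prod_{i=0}^{B-1}\frac{[k-i]}{[B-i]}\right)^{-1}\frac{\prod_{i=(a+b-k)/2}^{(a+b+k)/2}[i]}{\sqrt{[a][b]}},\qquad B=\tfrac{a-b+k}2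 .$$ *Face weights.* Heights are integers. Write $\overline W(a,b;d,c|u)$ for the weight of a face with upper left, upper right, lower left and lower right heights $a,b,d,c$; it is $0$ unless adjacent heights differ by $\pm1$, and $$\overline W(n,n\pm1;n\pm1,n\pm2|u)=1,\quad \overline W(n,n\pm1;n\pm1,n|u)=\frac{[n\mp u][1]}{[n][1+u]},\quad \overline W(n,n\pm1;n\mp1,n|u)=\frac{[n\pm1][u]}{[n][1+u]}.$$ Its fusions are $$\overline W_{k,1}(a,b;d,c|u)=\sum_{d_1,\dots,d_{k-1}}\prod_{j=0}^{k-1}\overline W(a_j,a_{j+1};d_j,d_{j+1}|u+k-1-j),$$ $$\overline W_{k,k}(a,b;d,c|u)=\sum_{a_1,\dots,a_{k-1}}\prod_{i=0}^{k-1}\overline W_{k,1}(a_i,b_i;a_{i+1},b_{i+1}|u-k+1+i),$$ where in the first formula $a_0=a,\ a_k=b,\ d_0=d,\ d_k=c$, and in the second $a_0=a,\ a_k=d,\ b_0=b,\ b_k=c$. The heights not summed over form an arbitrarily chosen path with steps $\pm1$ between the given end points (one choice for each pair of end points); the weight is $0$ if there is none. *$L$-matrix.* For $|a-b|=1$ put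 $\psi_+(u)^a_b=\vartheta_0\bigl(\frac{(a-b)u+a}{2r}\big|\frac\tau2\bigr)$, $\psi_-(u)^a_b=\vartheta_3\bigl(\frac{(a-b)u+a}{2r}\big|\frac\tau2\bigr)$ and $\psi^*_\varepsilon(u)^a_b=-\varepsilon\frac{a-b}{2[b][u]}C^2\psi_{-\varepsilon}(u-1)^a_b$. For $\epsilon\in\{-k,-k+2,\dots,k\}$ let $$\psi^{(k)}_\epsilon(u)^a_b=\sum_{\varepsilon_1+\dots+\varepsilon_k=\epsilon}\ \prod_{i=1}^{k}\psi_{\varepsilon_i}(u+k-i)^{c_{i-1}}_{c_i},\qquad \psi^{*(k)}_\epsilon(u)^b_a=\sum_{c_1,\dots,c_{k-1}}\ \prod_{i=1}^{k}\psi^*_{\varepsilon_i}(u+k-i)^{c_i}_{c_{i-1}},$$ with $c_0=a$, $c_k=b$ and $|c_i-c_{i-1}|=1$, where the $c_i$ in the first formula and the $\varepsilon_i\in\{\pm1\}$ with sum $\epsilon$ in the second are chosen arbitrarily. Put $L^{(k)}(a,b;c,d|u)=\sum_\epsilon\psi^{*(k)}_\epsilon(u)^d_c\,\psi^{(k)}_\epsilon(u)^a_b$.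 **Proposition.** Let $n\in\mathbb Z$. (a) Let $0\le s\le k$, let $[a]\neq0$ for all integers $n-s\le a\le n+2k$, and let $[u+j]\ne0$ for all integers $2-k\le j\le k$ (so that all weights involved are defined). Then, for all choices of intermediate variables, $$\overline W_{k,k}(n,n+k;n+k-2s,n|u)=(-1)^{k-s}\sqrt{\frac{[n+k-2s][n+2k]}{[n+k][n]}}\;\frac{(n+2k,n+k)_k}{(n,n+k-2s)_k}\;L^{(k)}(n,n+k-2s;n+2k,n+k|u+1).$$ (b) Consequently the integrands of the tail/vertex and of the vertex/vertex operator commutation relations agree up to a factor. Let $[a]\ne0$ for all integers $n-k\le a\le n+2k$ and $[u_1-u_2+j]\neq0$ for all integers $2-k\le j\le k$. For $v=(v_1,\dots,v_k)\in\mathbb C^k$ put $$I_{\hat\Phi}(v|u_1,u_2)=\prod_{j=1}^k\frac{[u_1-v_j-\frac k2][u_2-v_j+n-\frac k2+2j-1]}{[u_1-v_j+\frac k2][u_2-v_j+\frac k2]}-\sum_{s=0}^k\overline W_{k,k}(n,n+k;n+k-2s,n|u_1-u_2)\prod_{j=1}^{k-s}\frac{[u_2-v_j-\frac k2][u_1-v_j+n-\frac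 k2+2j-1]}{[u_2-v_j+\frac k2][u_1-v_j+\frac k2]}\prod_{j=k-s+1}^k\frac{[u_2-v_j+n-\frac{3k}2+2j-1]}{[u_2-v_j+\frac k2]},$$ $$I_\Lambda(v|u_1,u_2)=(-1)^k\sqrt{\tfrac{[n]}{[n+2k]}}\frac1{(n+k,n+2k)_k}\prod_{j=1}^k\frac{[u_1-v_j-\frac k2][-u_2-v_j+n-\frac k2+2j-1]}{[u_1-v_j+\frac k2][-u_2-v_j-\frac k2]}-\sum_{s=0}^kL^{(k)}(n,n+k-2s;n+2k,n+k|u_1+u_2+1)(-1)^s\sqrt{\tfrac{[n+k-2s]}{[n+k]}}\frac1{(n,n+k-2s)_k}\prod_{j=1}^{k-s}\frac{[u_1-v_j+n-\frac k2+2j-1]}{[u_1-v_j+\frac k2]}\prod_{j=k-s+1}^k\frac{[-u_2-v_j+n-\frac{3k}2+2j-1]}{[-u_2-v_j-\frac k2]}.$$ For all $v$ at which none of $[u_1-v_j+\frac k2]$, $[u_2-v_j\pm\frac k2]$ and $[v_i-v_j+1]$ $(i\ne j)$ vanishes, $$I_{\hat\Phi}(v|u_1,u_2)=(-1)^k\sqrt{\tfrac{[n+2k]}{[n]}}\,(n+k,n+2k)_k\,I_\Lambda(v|u_1,-u_2)\prod_{j=1}^k\frac{[u_2-v_j-\frac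 k2]}{[u_2-v_j+\frac k2]},$$ and $I_\Lambda(\cdot|u_1,-u_2)\sim0$ if and only if $I_{\hat\Phi}(\cdot|u_1,u_2)\sim0$, where $f\sim0$ means that $$\sum_{\sigma\in S_k}\ \prod_{i<j,\ \sigma(i)>\sigma(j)}\frac{[v_{\sigma(i)}-v_{\sigma(j)}-1]}{[v_{\sigma(i)}-v_{\sigma(j)}+1]}\;f(v_{\sigma(1)},\dots,v_{\sigma(k)})=0\quad\text{for all such }v.$$ -/

import Mathlib

noncomputable section

open Complex Finset

namespace FusionSOS

/-! ### Theta functions and the elliptic number `[u]` -/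

/-- `ϑ₁(u|τ) = 2 p^{1/8} (p;p)_∞ sin(πu) ∏_{n≥1} (1 - 2 pⁿ cos 2πu + p^{2n})`, `p = e^{2πiτ}`. -/
def theta1 (u τ : ℂ) : ℂ :=
  2 * exp (Real.pi * I * τ / 4) * (∏' n : ℕ, (1 - exp (2 * Real.pi * I * τ) ^ (n + 1))) *
    sin (Real.pi * u) *
    ∏' n : ℕ, (1 - 2 * exp (2 * Real.pi * I * τ) ^ (n + 1) * cos (2 * Real.pi * u) +
      exp (2 * Real.pi * I * τ) ^ (2 * (n + 1)))

/-- `ϑ₀(u|τ) = -i e^{πi(u+τ/4)} ϑ₁(u + τ/2|τ)`. -/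
def theta0 (u τ : ℂ) : ℂ :=
  -I * exp (Real.pi * I * (u + τ / 4)) * theta1 (u + τ / 2) τ

/-- `ϑ₃(u|τ) = e^{πi(u+τ/4)} ϑ₁(u + (τ+1)/2|τ)`. -/
def theta3 (u τ : ℂ) : ℂ :=
  exp (Real.pi * I * (u + τ / 4)) * theta1 (u + (τ + 1) / 2) τ

/-- The logarithm of `x`: `x^{2r} = e^{-2πi/τ}`, that is `x = exp (-πi/(τ r))`. -/
def logX (τ r : ℂ) : ℂ := -(Real.pi * I) / (τ * r)

/-- `C = x^{-r/4} e^{-πi/4} τ^{1/2}`. -/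
def constC (τ r : ℂ) : ℂ :=
  exp (-(r / 4) * logX τ r) * exp (-(Real.pi * I) / 4) * τ ^ (1 / 2 : ℂ)

/-- The elliptic number `[u] = C ϑ₁(u/r|τ)`. -/
def br (τ r u : ℂ) : ℂ := constC τ r * theta1 (u / r) τ

/-- The elliptic binomial `[A][A-1]⋯[A-B+1] / ([B][B-1]⋯[1])`. -/
def ellBinom (τ r : ℂ) (A B : ℕ) : ℂ :=
  (∏ i ∈ range B, br τ r ((A : ℂ) - i)) / ∏ i ∈ range B, br τ r ((B : ℂ) - i)

/-- `(a,b)_M`; here `g a` is a fixed square root of `[a]`, and `√([a][b])` is `g a * g b`. -/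
def abSym (τ r : ℂ) (g : ℤ → ℂ) (M : ℕ) (a b : ℤ) : ℂ :=
  (ellBinom τ r M ((a - b + M) / 2).toNat)⁻¹ *
    ((∏ i ∈ Icc ((a + b - M) / 2) ((a + b + M) / 2), br τ r (i : ℂ)) / (g a * g b))

/-! ### Admissible paths of heights

A path of `k` steps `±1` is its first height together with its steps `Fin k → ℤˣ`. -/

/-- The set `{-k, -k+2, …, k}`. -/
def weights (k : ℕ) : Finset ℤ := (range (k + 1)).image fun j : ℕ => (k : ℤ) - 2 * j

/-- The height after `i` steps of the path that starts at `a`. -/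
def height {k : ℕ} (a : ℤ) (e : Fin k → ℤˣ) (i : ℕ) : ℤ :=
  a + ∑ j : Fin k, if (j : ℕ) < i then (e j : ℤ) else 0

/-- The sign sequences of length `k` with sum `ε`. -/
def signs (k : ℕ) (ε : ℤ) : Finset (Fin k → ℤˣ) :=
  univ.filter fun e => ∑ i, (e i : ℤ) = ε

/-- `P` picks for every admissible pair `(a, b)` the steps of a path from `a` to `b`. -/
def IsPathChoice {k : ℕ} (P : ℤ → ℤ → Fin k → ℤˣ) : Prop :=
  ∀ a b : ℤ, b - a ∈ weights k → P a b ∈ signs k (b - a)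

/-- `E` picks for every `ε ∈ {-k, -k+2, …, k}` signs with sum `ε`. -/
def IsSignChoice {k : ℕ} (E : ℤ → Fin k → ℤˣ) : Prop :=
  ∀ ε ∈ weights k, E ε ∈ signs k ε

/-! ### Face weights and their fusion

The arguments `a b d c` are the heights at the upper left, upper right, lower left and
lower right corner of the face. -/

/-- The SOS face weight, without the scalar factor: it is `1` at `(n, n±1; n±1, n±2)`. -/
def face (τ r : ℂ) (a b d c : ℤ) (u : ℂ) : ℂ :=
  if |b - a| = 1 ∧ |d - a| = 1 ∧ |c - b| = 1 ∧ |c - d| = 1 then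
    if c = a then
      if b = d then
        br τ r ((a : ℂ) - ((b - a : ℤ) : ℂ) * u) * br τ r 1 / (br τ r (a : ℂ) * br τ r (1 + u))
      else br τ r (b : ℂ) * br τ r u / (br τ r (a : ℂ) * br τ r (1 + u))
    else 1
  else 0

/-- The `k × 1` fusion: the upper path is the one chosen by `P`, the lower one is summed over. -/
def faceK1 (τ r : ℂ) {k : ℕ} (P : ℤ → ℤ → Fin k → ℤˣ) (a b d c : ℤ) (u : ℂ) : ℂ :=
  if b - a ∈ weights k then
    ∑ e ∈ signs k (c - d), ∏ j : Fin k,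
      face τ r (height a (P a b) j) (height a (P a b) (j + 1)) (height d e j) (height d e (j + 1))
        (u + k - 1 - (j : ℕ))
  else 0

/-- The `k × k` fusion: the right path is the one chosen by `Q`, the left one is summed over. -/
def faceKK (τ r : ℂ) {k : ℕ} (P Q : ℤ → ℤ → Fin k → ℤˣ) (a b d c : ℤ) (u : ℂ) : ℂ :=
  if c - b ∈ weights k then
    ∑ e ∈ signs k (d - a), ∏ i : Fin k,
      faceK1 τ r P (height a e i) (height b (Q b c) i) (height a e (i + 1))
        (height b (Q b c) (i + 1)) (u - k + 1 + (i : ℕ))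
  else 0

/-! ### Intertwining vectors, their fusion, and the `L`-matrix -/

/-- The component `ψ_ε(u)^a_b` of the intertwining vector. -/
def psi (τ r : ℂ) (ε : ℤˣ) (u : ℂ) (a b : ℤ) : ℂ :=
  if ε = 1 then theta0 ((((a - b : ℤ) : ℂ) * u + a) / (2 * r)) (τ / 2)
  else theta3 ((((a - b : ℤ) : ℂ) * u + a) / (2 * r)) (τ / 2)

/-- The component `ψ*_ε(u)^a_b` of the dual intertwining vector. -/
def psiStar (τ r : ℂ) (ε : ℤˣ) (u : ℂ) (a b : ℤ) : ℂ :=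
  -((ε : ℤ) : ℂ) * (((a - b : ℤ) : ℂ) / (2 * br τ r (b : ℂ) * br τ r u)) * constC τ r ^ 2 *
    psi τ r (-ε) (u - 1) a b

/-- The component `ψ^{(k)}_ε(u)^a_b`, along the path from `a` to `b` chosen by `P`. -/
def psiK (τ r : ℂ) {k : ℕ} (P : ℤ → ℤ → Fin k → ℤˣ) (ε : ℤ) (u : ℂ) (a b : ℤ) : ℂ :=
  if b - a ∈ weights k then
    ∑ e ∈ signs k ε, ∏ i : Fin k,
      psi τ r (e i) (u + k - 1 - (i : ℕ)) (height a (P a b) i) (height a (P a b) (i + 1))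
  else 0

/-- The component `ψ*^{(k)}_ε(u)^b_a`, computed with the signs chosen by `E`;
the paths from `a` to `b` are summed over. -/
def psiStarK (τ r : ℂ) {k : ℕ} (E : ℤ → Fin k → ℤˣ) (ε : ℤ) (u : ℂ) (b a : ℤ) : ℂ :=
  ∑ e ∈ signs k (b - a), ∏ i : Fin k,
    psiStar τ r (E ε i) (u + k - 1 - (i : ℕ)) (height a e (i + 1)) (height a e i)

/-- The `L`-matrix `L^{(k)}(a, b; c, d | u) = ∑_ε ψ*^{(k)}_ε(u)^d_c ψ^{(k)}_ε(u)^a_b`. -/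
def Lmat (τ r : ℂ) {k : ℕ} (P : ℤ → ℤ → Fin k → ℤˣ) (E : ℤ → Fin k → ℤˣ)
    (a b c d : ℤ) (u : ℂ) : ℂ :=
  ∑ ε ∈ weights k, psiStarK τ r E ε u d c * psiK τ r P ε u a b

/-! ### The integrands of the two commutation relations

The integration variables `v₁, …, v_k` are `v : Fin k → ℂ`, so `v j` is the `(j+1)`-st one. -/

/-- The integrand for the relation between the vertex operators `Φ̂_{-k}` and `Φ̂_k`. -/
def IPhi (τ r : ℂ) {k : ℕ} (P Q : ℤ → ℤ → Fin k → ℤˣ) (n : ℤ) (u₁ u₂ : ℂ)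
    (v : Fin k → ℂ) : ℂ :=
  (∏ j : Fin k, br τ r (u₁ - v j - k / 2) / br τ r (u₁ - v j + k / 2)) *
      (∏ j : Fin k, br τ r (u₂ - v j + n - k / 2 + 2 * ((j : ℕ) + 1) - 1) /
        br τ r (u₂ - v j + k / 2)) -
    ∑ s ∈ range (k + 1), faceKK τ r P Q n (n + k) (n + k - 2 * s) n (u₁ - u₂) *
      (∏ j : Fin k with j.val < k - s,
        br τ r (u₂ - v j - k / 2) / br τ r (u₂ - v j + k / 2)) *
      (∏ j : Fin k with j.val < k - s,
        br τ r (u₁ - v j + n - k / 2 + 2 * ((j : ℕ) + 1) - 1) / br τ r (u₁ - v j + k / 2)) *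
      ∏ j : Fin k with k - s ≤ j.val,
        br τ r (u₂ - v j + n - 3 * k / 2 + 2 * ((j : ℕ) + 1) - 1) / br τ r (u₂ - v j + k / 2)

/-- The integrand for the relation between the tail operator `Λ_{-2k}` and `Φ_k`. -/
def ILambda (τ r : ℂ) (g : ℤ → ℂ) {k : ℕ} (P : ℤ → ℤ → Fin k → ℤˣ) (E : ℤ → Fin k → ℤˣ)
    (n : ℤ) (u₁ u₂ : ℂ) (v : Fin k → ℂ) : ℂ :=
  (-1) ^ k * (g n / g (n + 2 * k)) * (1 / abSym τ r g k (n + k) (n + 2 * k)) *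
      (∏ j : Fin k, br τ r (u₁ - v j - k / 2) / br τ r (u₁ - v j + k / 2)) *
      (∏ j : Fin k, br τ r (-u₂ - v j + n - k / 2 + 2 * ((j : ℕ) + 1) - 1) /
        br τ r (-u₂ - v j - k / 2)) -
    ∑ s ∈ range (k + 1),
      Lmat τ r P E n (n + k - 2 * s) (n + 2 * k) (n + k) (u₁ + u₂ + 1) * (-1) ^ s *
      (g (n + k - 2 * s) / g (n + k)) * (1 / abSym τ r g k n (n + k - 2 * s)) *
      (∏ j : Fin k with j.val < k - s,
        br τ r (u₁ - v j + n - k / 2 + 2 * ((j : ℕ) + 1) - 1) / br τ r (u₁ - v j + k / 2)) *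
      ∏ j : Fin k with k - s ≤ j.val,
        br τ r (-u₂ - v j + n - 3 * k / 2 + 2 * ((j : ℕ) + 1) - 1) / br τ r (-u₂ - v j - k / 2)

/-- The points `v` at which none of the denominators occurring in `IPhi τ r P Q n u₁ u₂`, in
`ILambda τ r g P E n u₁ (-u₂)` and in the weak equality vanishes. -/
def generic (τ r : ℂ) (k : ℕ) (u₁ u₂ : ℂ) : Set (Fin k → ℂ) :=
  {v | (∀ j, br τ r (u₁ - v j + k / 2) ≠ 0 ∧ br τ r (u₂ - v j + k / 2) ≠ 0 ∧
      br τ r (u₂ - v j - k / 2) ≠ 0) ∧ ∀ i j, i ≠ j → br τ r (v i - v j + 1) ≠ 0}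

/-- `f ∼ 0`: the symmetrisation of `f` vanishes, where reordering the product
`F(v₁)⋯F(v_k)` costs a factor `[v - w - 1]/[v - w + 1]` for each exchange
`F(v)F(w) → F(w)F(v)`. -/
def WeaklyZero (τ r : ℂ) {k : ℕ} (G : Set (Fin k → ℂ)) (f : (Fin k → ℂ) → ℂ) : Prop :=
  ∀ v ∈ G, ∑ σ : Equiv.Perm (Fin k),
    (∏ i : Fin k, ∏ j : Fin k with i < j ∧ σ j < σ i,
      br τ r (v (σ i) - v (σ j) - 1) / br τ r (v (σ i) - v (σ j) + 1)) *
      f (fun i => v (σ i)) = 0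

end FusionSOS

end

open FusionSOS

noncomputable section

open Complex Finset

namespace FusionSOS

/-! Part (a) holds because both sides are explicit products of elliptic numbers.

On the `L` side the path from `n + 2k` to `n + k` must descend at every step, and then all `k` dual
vectors carry the same theta argument `n + k - u`. Up to scalars their product depends only on the
sum of the signs, so the sum over `ε` opens up into a sum over all sign sequences and factorises
into `k` two-term sums `ϑ₃ϑ₀ - ϑ₀ϑ₃` of modulus `τ/2`. Each of these is a product of two `ϑ₁` of
modulus `τ` (`theta3_mul_theta0_sub`), which gives `Lmat_eq_prod`.

On the face side the right path from `n + k` to `n` is also forced to descend. Each row of the `k ×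
k` fusion is then a `k × 1` fusion with a closed form (`faceSum_eq`). The sum over left paths obeys
a Pascal-type recursion in the numbers of ascents and descents, solved by `rowProd`
(`pathSum_eq_rowProd`). Both inductions rest on the three-term identity `br_three_term`, which is a
Plücker relation because `[x+y][x-y]` is a 2 × 2 determinant in `ϑ₃` and `ϑ₀`.

The theta identities are proved on Fourier series, whereas `theta1` is defined by a product; the
Jacobi triple product links the two, and is obtained as a limit of the `q`-binomial theorem.

Part (b) follows term by term from (a): the two integrands differ by a factor that is symmetric in
the `v_j` and nonzero at generic points, so it passes through the symmetrisation. -/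

/-! ### The Jacobi triple product -/

/-- The `q`-Pochhammer symbol `(p; p)_m`. -/
def qPoch (p : ℂ) (m : ℕ) : ℂ := ∏ i ∈ range m, (1 - p ^ (i + 1))

theorem qPoch_succ (p : ℂ) (m : ℕ) : qPoch p (m + 1) = qPoch p m * (1 - p ^ (m + 1)) :=
  prod_range_succ _ _

theorem one_sub_pow_ne_zero {p : ℂ} (hp : ‖p‖ < 1) (m : ℕ) : 1 - p ^ (m + 1) ≠ 0 := by
  intro h
  have h1 : ‖p ^ (m + 1)‖ = 1 := by rw [← sub_eq_zero.1 h]; simp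
  rw [norm_pow] at h1
  exact absurd h1 (pow_lt_one₀ (norm_nonneg _) hp (Nat.succ_ne_zero m)).ne

theorem qPoch_ne_zero {p : ℂ} (hp : ‖p‖ < 1) (m : ℕ) : qPoch p m ≠ 0 :=
  prod_ne_zero_iff.2 fun i _ => one_sub_pow_ne_zero hp i

/-- The Gaussian binomial coefficient. -/
def qBinom (p : ℂ) (m j : ℕ) : ℂ := qPoch p m / (qPoch p j * qPoch p (m - j))

theorem qBinom_zero {p : ℂ} (hp : ‖p‖ < 1) (m : ℕ) : qBinom p m 0 = 1 := by
  have := qPoch_ne_zero hp m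
  simp [qBinom, qPoch] at this ⊢
  exact this

theorem qBinom_self {p : ℂ} (hp : ‖p‖ < 1) (m : ℕ) : qBinom p m m = 1 := by
  have := qPoch_ne_zero hp m
  simp [qBinom, qPoch] at this ⊢
  exact this

/-- The bound `j < m` is essential: by truncated subtraction `qBinom p m (m + 1)` is not `0`, so the
rule fails at `j = m`. This is why the extreme terms are split off in the `q`-binomial theorem. -/
theorem qBinom_succ_succ {p : ℂ} (hp : ‖p‖ < 1) (m j : ℕ) (hj : j < m) :
    qBinom p (m + 1) (j + 1) = qBinom p m (j + 1) + qBinom p m j * p ^ (m - j) := by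
  obtain ⟨d, rfl⟩ := Nat.exists_eq_add_of_lt hj
  have h1 : j + d + 1 + 1 - (j + 1) = d + 1 := by omega
  have h2 : j + d + 1 - (j + 1) = d := by omega
  have h3 : j + d + 1 - j = d + 1 := by omega
  have e1 := one_sub_pow_ne_zero hp j
  have e2 := one_sub_pow_ne_zero hp d
  have e3 := qPoch_ne_zero hp j
  have e4 := qPoch_ne_zero hp d
  simp only [qBinom, h1, h2, h3]
  rw [qPoch_succ p (j + d + 1), qPoch_succ p j, qPoch_succ p d]
  field_simp
  ring

/-- The `q`-binomial theorem. -/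
theorem prod_one_sub_mul_pow {p : ℂ} (hp : ‖p‖ < 1) (x : ℂ) (m : ℕ) :
    ∏ i ∈ range m, (1 - x * p ^ i) =
      ∑ j ∈ range (m + 1), (-x) ^ j * p ^ (j.choose 2) * qBinom p m j := by
  induction m with
  | zero => simp [qBinom, qPoch]
  | succ m ih =>
    have e1 := sum_range_succ' (fun j => (-x) ^ j * p ^ (j.choose 2) * qBinom p m j) m
    have e2 := sum_range_succ (fun j => (-x) ^ j * p ^ (j.choose 2) * qBinom p m j) m
    rw [prod_range_succ, ih, mul_sub, mul_one]
    nth_rewrite 2 [e2]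
    rw [e1, sum_range_succ' _ (m + 1), sum_range_succ _ m]
    have h : ∀ j ∈ range m, (-x) ^ (j + 1) * p ^ ((j + 1).choose 2) * qBinom p (m + 1) (j + 1) =
        (-x) ^ (j + 1) * p ^ ((j + 1).choose 2) * qBinom p m (j + 1) +
        (-x) * p ^ m * ((-x) ^ j * p ^ (j.choose 2) * qBinom p m j) := by
      intro j hj
      have hjm := mem_range.1 hj
      rw [qBinom_succ_succ hp m j hjm, Nat.choose_succ_succ' j 1, Nat.choose_one_right, pow_add,
        show p ^ m = p ^ j * p ^ (m - j) by rw [← pow_add]; congr 1; omega]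
      ring
    rw [sum_congr rfl h, sum_add_distrib, ← mul_sum, qBinom_zero hp, qBinom_zero hp,
      qBinom_self hp, qBinom_self hp, Nat.choose_succ_succ' m 1, Nat.choose_one_right, pow_add]
    ring

/-- The finite form of the Jacobi triple product, with `p = q ^ 2`. -/
theorem finite_triple_product {q : ℂ} (hq : ‖q‖ < 1) (hq0 : q ≠ 0) {X : ℂ} (hX : X ≠ 0) (m : ℕ) :
    (1 - X) * ∏ i ∈ range m, ((1 - X * (q ^ 2) ^ (i + 1)) * (1 - X⁻¹ * (q ^ 2) ^ (i + 1))) =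
      ∑ j ∈ range (2 * m + 2), (-X) ^ ((j : ℤ) - m) *
        q ^ (((j : ℤ) - m) * ((j : ℤ) - m - 1)) * qBinom (q ^ 2) (2 * m + 1) j := by
  have hp : ‖q ^ 2‖ < 1 := by
    rw [norm_pow]; exact pow_lt_one₀ (norm_nonneg _) hq two_ne_zero
  -- The shift by `p ^ (-m)` centres the `2m + 1` factors: the one with `i = m` is `1 - X`, and
  -- those with `i < m` are reflected by `1 - X p⁻ˡ = -X p⁻ˡ (1 - X⁻¹ pˡ)`.
  have hmain := prod_one_sub_mul_pow hp (X * ((q ^ 2) ^ m)⁻¹) (2 * m + 1)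
  have hleft : ∏ i ∈ range (2 * m + 1), (1 - X * ((q ^ 2) ^ m)⁻¹ * (q ^ 2) ^ i) =
      (-X) ^ m * q ^ (-((m : ℤ) * (m + 1))) * ((1 - X) * ∏ i ∈ range m,
        ((1 - X * (q ^ 2) ^ (i + 1)) * (1 - X⁻¹ * (q ^ 2) ^ (i + 1)))) := by
    rw [show 2 * m + 1 = m + (m + 1) by ring, prod_range_add, prod_range_succ', prod_mul_distrib]
    have h1 : ∀ i, 1 - X * ((q ^ 2) ^ m)⁻¹ * (q ^ 2) ^ (m + (i + 1)) =
        1 - X * (q ^ 2) ^ (i + 1) := by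
      intro i; rw [pow_add _ m]; field_simp
    have h2 : ∏ i ∈ range m, (1 - X * ((q ^ 2) ^ m)⁻¹ * (q ^ 2) ^ i) =
        (-X) ^ m * q ^ (-((m : ℤ) * (m + 1))) *
          ∏ i ∈ range m, (1 - X⁻¹ * (q ^ 2) ^ (i + 1)) := by
      rw [← prod_range_reflect]
      have h3 : ∀ i ∈ range m, 1 - X * ((q ^ 2) ^ m)⁻¹ * (q ^ 2) ^ (m - 1 - i) =
          (-X) * ((q ^ 2) ^ (i + 1))⁻¹ * (1 - X⁻¹ * (q ^ 2) ^ (i + 1)) := by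
        intro i hi
        have him := mem_range.1 hi
        rw [show (q ^ 2) ^ m = (q ^ 2) ^ (i + 1) * (q ^ 2) ^ (m - 1 - i) by
          rw [← pow_add]; congr 1; omega]
        field_simp
        ring
      rw [prod_congr rfl h3, prod_mul_distrib, prod_mul_distrib, prod_const, card_range]
      congr 2
      clear hmain h1 h3
      induction m with
      | zero => simp
      | succ m ih =>
        rw [prod_range_succ, ih, ← zpow_natCast, ← zpow_natCast, ← zpow_mul, ← zpow_neg,
          ← zpow_add₀ hq0]
        congr 1
        push_cast; ring
    rw [prod_congr rfl fun i _ => h1 i, h2]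
    have h4 : 1 - X * ((q ^ 2) ^ m)⁻¹ * (q ^ 2) ^ (m + 0) = 1 - X := by
      rw [add_zero]; field_simp
    rw [h4]; ring
  rw [hleft] at hmain
  have hA : (-X) ^ m * q ^ (-((m : ℤ) * (m + 1))) ≠ 0 :=
    mul_ne_zero (pow_ne_zero _ (neg_ne_zero.2 hX)) (zpow_ne_zero _ hq0)
  apply mul_left_cancel₀ hA
  rw [hmain, mul_sum]
  refine sum_congr rfl fun j _ => ?_
  rw [← mul_assoc, mul_mul_mul_comm, ← zpow_natCast (-X) m,
    ← zpow_add₀ (neg_ne_zero.2 hX), ← zpow_add₀ hq0, show -(X * ((q ^ 2) ^ m)⁻¹) =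
      (-X) * ((q ^ 2) ^ m)⁻¹ by ring, mul_pow]
  have h5 : ((m : ℤ) + ((j : ℤ) - m)) = (j : ℕ) := by ring
  rw [h5, zpow_natCast]
  congr 1
  rw [mul_assoc]
  congr 1
  rw [← pow_mul q, ← zpow_natCast q (2 * m), ← zpow_neg, ← zpow_natCast, ← zpow_mul,
    ← pow_mul, ← zpow_natCast, ← zpow_add₀ hq0]
  congr 1
  have h6 : ((j.choose 2 : ℕ) : ℤ) * 2 = j * (j - 1) := by
    rw [Nat.choose_two_right]
    have := Nat.div_mul_cancel (Nat.even_mul_pred_self j).two_dvd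
    have h7 : ((j * (j - 1) / 2 * 2 : ℕ) : ℤ) = ((j * (j - 1) : ℕ) : ℤ) := by rw [this]
    rcases j with _ | j
    · simp
    · push_cast at h7 ⊢; simpa using h7
  push_cast
  linear_combination h6

open Filter Topology in
theorem tendsto_qPoch {p : ℂ} (hp : ‖p‖ < 1) :
    Tendsto (qPoch p) atTop (𝓝 (∏' m : ℕ, (1 - p ^ (m + 1)))) :=
  (ModularForm.multipliable_one_sub_pow hp).tendsto_prod_tprod_nat

theorem tprod_one_sub_pow_ne_zero {p : ℂ} (hp : ‖p‖ < 1) :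
    ∏' m : ℕ, (1 - p ^ (m + 1)) ≠ 0 := by
  have := tprod_one_add_ne_zero_of_summable (f := fun m : ℕ => -p ^ (m + 1))
    (fun i => by rw [← sub_eq_add_neg]; exact one_sub_pow_ne_zero hp i)
    (by simpa [pow_succ] using (summable_geometric_of_lt_one (norm_nonneg p) hp).mul_right ‖p‖)
  simpa [← sub_eq_add_neg] using this

/-- `(p; p)_m` converges to a nonzero limit, so both it and its inverse are bounded. The uniform
bound supplies the domination in the limit of the finite triple product. -/
theorem exists_norm_qBinom_le {p : ℂ} (hp : ‖p‖ < 1) : ∃ K, ∀ m j, ‖qBinom p m j‖ ≤ K := by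
  obtain ⟨A, hA⟩ := (tendsto_qPoch hp).norm.bddAbove_range
  obtain ⟨B, hB⟩ := ((tendsto_qPoch hp).inv₀ (tprod_one_sub_pow_ne_zero hp)).norm.bddAbove_range
  have hA' : ∀ m, ‖qPoch p m‖ ≤ A := fun m => hA ⟨m, rfl⟩
  have hB' : ∀ m, ‖(qPoch p m)⁻¹‖ ≤ B := fun m => hB ⟨m, rfl⟩
  refine ⟨A * (B * B), fun m j => ?_⟩
  rw [qBinom, div_eq_mul_inv, mul_inv, norm_mul, norm_mul]
  have hA0 := (norm_nonneg _).trans (hA' 0)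
  have hB0 := (norm_nonneg _).trans (hB' 0)
  gcongr
  exacts [hA' m, hB' j, hB' _]

open Filter Topology in
theorem tendsto_sum_mul_qBinom {p : ℂ} (hp : ‖p‖ < 1) {t : ℤ → ℂ} (ht : Summable fun n => ‖t n‖) :
    Tendsto (fun m : ℕ => ∑ j ∈ range (2 * m + 2), t ((j : ℤ) - m) * qBinom p (2 * m + 1) j) atTop
      (𝓝 ((∑' n, t n) * (∏' m : ℕ, (1 - p ^ (m + 1)))⁻¹)) := by
  obtain ⟨K, hK⟩ := exists_norm_qBinom_le hp
  -- With `n = j - m` the range `0 ≤ j ≤ 2m + 1` becomes `-m ≤ n ≤ m + 1`. Extension by zero turns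
  -- the finite sums into sums over all of `ℤ`, as dominated convergence requires.
  set F : ℕ → ℤ → ℂ := fun m n =>
    if -(m : ℤ) ≤ n ∧ n ≤ m + 1 then t n * qBinom p (2 * m + 1) (n + m).toNat else 0 with hF
  have hsum : ∀ m : ℕ, ∑ j ∈ range (2 * m + 2), t ((j : ℤ) - m) * qBinom p (2 * m + 1) j =
      ∑' n, F m n := by
    intro m
    rw [tsum_eq_sum (s := Finset.Icc (-(m : ℤ)) (m + 1))]
    · refine sum_bij' (fun j _ => (j : ℤ) - m) (fun n _ => (n + m).toNat) ?_ ?_ ?_ ?_ ?_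
      · intro j hj; simp at hj ⊢; omega
      · intro n hn; simp at hn ⊢; omega
      · intro j hj; simp
      · intro n hn; simp at hn ⊢; omega
      · intro j hj
        have := mem_range.1 hj
        rw [hF]; dsimp only
        rw [if_pos (by omega)]
        simp
    · intro n hn
      rw [hF]; dsimp only
      rw [if_neg]
      simpa using hn
  simp only [hsum]
  rw [← tsum_mul_right]
  refine tendsto_tsum_of_dominated_convergence (bound := fun n => ‖t n‖ * K) (ht.mul_right K) ?_ ?_
  · intro n
    have hQ := tendsto_qPoch hp
    have hQ0 := tprod_one_sub_pow_ne_zero hp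
    have h1 : Tendsto (fun m : ℕ => 2 * m + 1) atTop atTop :=
      tendsto_atTop_atTop.2 fun b => ⟨b, fun m hm => by omega⟩
    have h2 : Tendsto (fun m : ℕ => (n + m).toNat) atTop atTop :=
      tendsto_atTop_atTop.2 fun b => ⟨b + n.natAbs, fun m hm => by omega⟩
    have h3 : Tendsto (fun m : ℕ => 2 * m + 1 - (n + m).toNat) atTop atTop :=
      tendsto_atTop_atTop.2 fun b => ⟨b + n.natAbs, fun m hm => by omega⟩
    have h4 := ((hQ.comp h1).div ((hQ.comp h2).mul (hQ.comp h3)) (mul_ne_zero hQ0 hQ0)).const_mul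
      (t n)
    rw [show ∀ z : ℂ, z / (z * z) = z⁻¹ from fun z => by
      by_cases hz : z = 0
      · simp [hz]
      · field_simp] at h4
    refine h4.congr' ?_
    filter_upwards [eventually_ge_atTop n.natAbs] with m hm
    rw [hF]; dsimp only
    rw [if_pos (by omega)]
    rfl
  · refine Eventually.of_forall fun m n => ?_
    rw [hF]; dsimp only
    split_ifs
    · rw [norm_mul]; gcongr; exact hK _ _
    · rw [norm_zero]
      exact mul_nonneg (norm_nonneg _) ((norm_nonneg _).trans (hK 0 0))

open Filter Topology in
/-- The Jacobi triple product. -/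
theorem jacobi_triple_product {q : ℂ} (hq : ‖q‖ < 1) (hq0 : q ≠ 0) {X : ℂ} (hX : X ≠ 0)
    (ht : Summable fun n : ℤ => ‖(-X) ^ n * q ^ (n * (n - 1))‖) :
    (∏' m : ℕ, (1 - (q ^ 2) ^ (m + 1))) * ((1 - X) *
      ∏' m : ℕ, ((1 - X * (q ^ 2) ^ (m + 1)) * (1 - X⁻¹ * (q ^ 2) ^ (m + 1)))) =
      ∑' n : ℤ, (-X) ^ n * q ^ (n * (n - 1)) := by
  have hp : ‖q ^ 2‖ < 1 := by
    rw [norm_pow]; exact pow_lt_one₀ (norm_nonneg _) hq two_ne_zero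
  have hmul : ∀ Y : ℂ, Multipliable fun m : ℕ => 1 - Y * (q ^ 2) ^ (m + 1) := by
    intro Y
    have := multipliable_one_add_of_summable (f := fun m : ℕ => -(Y * (q ^ 2) ^ (m + 1)))
      ((((summable_geometric_of_lt_one (norm_nonneg (q ^ 2)) hp).mul_right ‖q ^ 2‖).mul_left
        ‖Y‖).congr fun m => by rw [norm_neg, norm_mul, norm_pow (q ^ 2), pow_succ ‖q ^ 2‖])
    simpa [← sub_eq_add_neg] using this
  have h1 := (((hmul X).mul (hmul X⁻¹)).tendsto_prod_tprod_nat).const_mul (1 - X)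
  have h2 := tendsto_sum_mul_qBinom hp ht
  have h3 := tendsto_nhds_unique (h1.congr fun m => finite_triple_product hq hq0 hX m) h2
  rw [h3, mul_comm, inv_mul_cancel_right₀ (tprod_one_sub_pow_ne_zero hp)]

/-! ### The theta functions as Fourier series. -/

/-- With `X = e^{2πiu}` the sine supplies `1 - X` and each cosine factor splits as `(1 - X pᵐ)(1 -
X⁻¹ pᵐ)`, which is the product side of the triple product with `q = e^{πiτ}`. -/
theorem theta1_eq_jacobiTheta₂ (u : ℂ) {τ : ℂ} (hτ : 0 < τ.im) :
    theta1 u τ = I * exp (Real.pi * I * (τ / 4 - u)) * jacobiTheta₂ (u + 1 / 2 - τ / 2) τ := by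
  set q : ℂ := exp (Real.pi * I * τ) with hqdef
  set X : ℂ := exp (2 * Real.pi * I * u) with hXdef
  have hq : ‖q‖ < 1 := by
    rw [hqdef, norm_exp]
    simp
    positivity
  have hterm : ∀ n : ℤ, (-X) ^ n * q ^ (n * (n - 1)) =
      jacobiTheta₂_term n (u + 1 / 2 - τ / 2) τ := by
    intro n
    have hneg : -X = exp (2 * Real.pi * I * u + Real.pi * I) := by
      rw [exp_add, exp_pi_mul_I, hXdef]; ring
    rw [hneg, hqdef, ← exp_int_mul, ← exp_int_mul, ← exp_add, jacobiTheta₂_term]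
    congr 1
    push_cast
    ring
  have hs : Summable fun n : ℤ => ‖(-X) ^ n * q ^ (n * (n - 1))‖ := by
    simp only [hterm]
    exact ((summable_jacobiTheta₂_term_iff _ _).2 hτ).norm
  have hJ := jacobi_triple_product hq (exp_ne_zero _) (X := X) (exp_ne_zero _) hs
  simp only [hterm] at hJ
  rw [jacobiTheta₂, ← hJ]
  have hp : exp (2 * Real.pi * I * τ) = q ^ 2 := by
    rw [hqdef, ← exp_nat_mul]; congr 1; push_cast; ring
  have hcos : 2 * cos (2 * Real.pi * u) = X + X⁻¹ := by
    rw [two_cos, hXdef, ← exp_neg]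
    congr 2 <;> ring
  have hsin : 2 * sin (Real.pi * u) = I * exp (-(Real.pi * I * u)) * (1 - X) := by
    rw [two_sin, mul_sub, mul_one, mul_assoc I _ X, hXdef, ← exp_add]
    rw [show -(Real.pi * I * u) + 2 * Real.pi * I * u = Real.pi * u * I by ring,
      show -(Real.pi * u) * I = -(Real.pi * I * u) by ring]
    ring
  rw [theta1, hp]
  have hfac : ∀ m : ℕ, 1 - 2 * (q ^ 2) ^ (m + 1) * cos (2 * Real.pi * u) +
      (q ^ 2) ^ (2 * (m + 1)) = (1 - X * (q ^ 2) ^ (m + 1)) * (1 - X⁻¹ * (q ^ 2) ^ (m + 1)) := by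
    intro m
    have hX : X * X⁻¹ = 1 := mul_inv_cancel₀ (exp_ne_zero _)
    linear_combination (-(q ^ 2) ^ (m + 1)) * hcos - (q ^ 2) ^ (2 * (m + 1)) * hX
  simp only [hfac]
  have hexp : exp (Real.pi * I * (τ / 4 - u)) =
      exp (Real.pi * I * τ / 4) * exp (-(Real.pi * I * u)) := by
    rw [← exp_add]; congr 1; ring
  rw [hexp]
  linear_combination (exp (Real.pi * I * τ / 4) * (∏' n : ℕ, (1 - (q ^ 2) ^ (n + 1))) *
    ∏' m : ℕ, ((1 - X * (q ^ 2) ^ (m + 1)) * (1 - X⁻¹ * (q ^ 2) ^ (m + 1)))) * hsin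

theorem theta0_eq_jacobiTheta₂ (u : ℂ) {τ : ℂ} (hτ : 0 < τ.im) :
    theta0 u τ = jacobiTheta₂ (u + 1 / 2) τ := by
  rw [theta0, theta1_eq_jacobiTheta₂ _ hτ, show u + τ / 2 + 1 / 2 - τ / 2 = u + 1 / 2 by ring]
  have h : exp (Real.pi * I * (u + τ / 4)) * exp (Real.pi * I * (τ / 4 - (u + τ / 2))) = 1 := by
    rw [← exp_add, exp_eq_one_iff]; exact ⟨0, by push_cast; ring⟩
  linear_combination (-I * I * jacobiTheta₂ (u + 1 / 2) τ) * h - jacobiTheta₂ (u + 1 / 2) τ * I_sq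

theorem theta3_eq_jacobiTheta₂ (u : ℂ) {τ : ℂ} (hτ : 0 < τ.im) :
    theta3 u τ = jacobiTheta₂ u τ := by
  rw [theta3, theta1_eq_jacobiTheta₂ _ hτ,
    show u + (τ + 1) / 2 + 1 / 2 - τ / 2 = u + 1 by ring, jacobiTheta₂_add_left]
  have h : exp (Real.pi * I * (u + τ / 4)) * exp (Real.pi * I * (τ / 4 - (u + (τ + 1) / 2))) =
      -I := by
    rw [← exp_add, show Real.pi * I * (u + τ / 4) + Real.pi * I * (τ / 4 - (u + (τ + 1) / 2)) =
      -(Real.pi / 2 * I) by ring, exp_neg, exp_pi_div_two_mul_I, inv_I]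
  linear_combination (I * jacobiTheta₂ u τ) * h - jacobiTheta₂ u τ * I_sq

/-! ### Theta function identities -/

theorem jacobiTheta₂_term_add_half (n : ℤ) (z τ : ℂ) :
    jacobiTheta₂_term n (z + 1 / 2) τ = (-1) ^ n * jacobiTheta₂_term n z τ := by
  rw [jacobiTheta₂_term, jacobiTheta₂_term, ← exp_pi_mul_I, ← exp_int_mul, ← exp_add]
  congr 1; ring

theorem jacobiTheta₂_mul_sub_mul (w z : ℂ) {τ : ℂ} (hτ : 0 < τ.im) :
    jacobiTheta₂ w (τ / 2) * jacobiTheta₂ (z + 1 / 2) (τ / 2) -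
      jacobiTheta₂ (w + 1 / 2) (τ / 2) * jacobiTheta₂ z (τ / 2) =
    2 * (exp (Real.pi * I * (τ / 2 - 2 * w)) *
      (jacobiTheta₂ (w + z + 1 / 2 - τ / 2) τ * jacobiTheta₂ (w - z + 1 / 2 - τ / 2) τ)) := by
  have hτ2 : 0 < (τ / 2).im := by
    rw [show τ / 2 = τ * ((1 / 2 : ℝ) : ℂ) by push_cast; ring, im_mul_ofReal]; positivity
  have hs2 : ∀ x : ℂ, Summable fun n => ‖jacobiTheta₂_term n x (τ / 2)‖ := fun x =>
    ((summable_jacobiTheta₂_term_iff x _).2 hτ2).norm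
  have hs : ∀ x : ℂ, Summable fun n => ‖jacobiTheta₂_term n x τ‖ := fun x =>
    ((summable_jacobiTheta₂_term_iff x _).2 hτ).norm
  simp only [jacobiTheta₂]
  rw [tsum_mul_tsum_of_summable_norm (hs2 _) (hs2 _),
    tsum_mul_tsum_of_summable_norm (hs2 _) (hs2 _), tsum_mul_tsum_of_summable_norm (hs _) (hs _),
    ← (summable_mul_of_summable_norm (hs2 _) (hs2 _)).tsum_sub
      (summable_mul_of_summable_norm (hs2 _) (hs2 _)), ← tsum_mul_left, ← tsum_mul_left]
  -- The `(m, n)` term of the difference carries `(-1)ⁿ - (-1)ᵐ`, so only pairs with `m + n` odd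
  -- survive, and `e` enumerates them. Under it `(m² + n²)/2 = a² + b² - a - b + 1/2`: the modulus
  -- passes from `τ/2` to `τ`, and the linear terms become the shifts by `-τ/2`.
  set e : ℤ × ℤ → ℤ × ℤ := fun x => (x.1 + x.2 - 1, x.1 - x.2) with he
  have hinj : Function.Injective e := by
    rintro ⟨a, b⟩ ⟨c, d⟩ h
    simp only [he, Prod.mk.injEq] at h ⊢
    omega
  rw [← hinj.tsum_eq]
  · refine tsum_congr fun x => ?_
    obtain ⟨a, b⟩ := x
    simp only [he, jacobiTheta₂_term_add_half]
    have hparity : (-1 : ℂ) ^ (a + b - 1) = -(-1) ^ (a - b) := by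
      rw [show a + b - 1 = a - b + 2 * (b - 1) + 1 by ring,
        zpow_add₀ (by norm_num), zpow_add₀ (by norm_num), zpow_mul]
      norm_num
    rw [hparity]
    have key : (-1 : ℂ) ^ (a - b) * (jacobiTheta₂_term (a + b - 1) w (τ / 2) *
        jacobiTheta₂_term (a - b) z (τ / 2)) = exp (Real.pi * I * (τ / 2 - 2 * w)) *
        (jacobiTheta₂_term a (w + z + 1 / 2 - τ / 2) τ *
          jacobiTheta₂_term b (w - z + 1 / 2 - τ / 2) τ) := by
      have hsgn : (-1 : ℂ) ^ (a - b) = exp ((a + b : ℤ) * (Real.pi * I)) := by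
        rw [exp_int_mul, exp_pi_mul_I, show a + b = a - b + 2 * b by ring,
          zpow_add₀ (by norm_num), zpow_mul]
        norm_num
      simp only [jacobiTheta₂_term, hsgn, ← exp_add]
      congr 1
      push_cast
      ring
    linear_combination 2 * key
  · rintro ⟨m, n⟩ hmn
    by_contra hr
    apply hmn
    have hpar : (-1 : ℂ) ^ m = (-1) ^ n := by
      have hev : Even (m + n) := by
        by_contra ho
        obtain ⟨c, hc⟩ := Int.not_even_iff_odd.1 ho
        exact hr ⟨(c + 1, c + 1 - n), by simp only [he, Prod.mk.injEq]; omega⟩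
      obtain ⟨c, hc⟩ := hev
      rw [show m = n + 2 * (c - n) by omega, zpow_add₀ (by norm_num), zpow_mul]
      norm_num
    simp only [jacobiTheta₂_term_add_half, hpar]
    ring

theorem theta3_mul_theta0_sub (w z : ℂ) {τ : ℂ} (hτ : 0 < τ.im) :
    theta3 w (τ / 2) * theta0 z (τ / 2) - theta0 w (τ / 2) * theta3 z (τ / 2) =
      -2 * (theta1 (w + z) τ * theta1 (w - z) τ) := by
  have hτ2 : 0 < (τ / 2).im := by
    rw [show τ / 2 = τ * ((1 / 2 : ℝ) : ℂ) by push_cast; ring, im_mul_ofReal]; positivity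
  rw [theta3_eq_jacobiTheta₂ _ hτ2, theta3_eq_jacobiTheta₂ _ hτ2, theta0_eq_jacobiTheta₂ _ hτ2,
    theta0_eq_jacobiTheta₂ _ hτ2, jacobiTheta₂_mul_sub_mul _ _ hτ, theta1_eq_jacobiTheta₂ _ hτ,
    theta1_eq_jacobiTheta₂ _ hτ]
  have h : exp (Real.pi * I * (τ / 4 - (w + z))) * exp (Real.pi * I * (τ / 4 - (w - z))) =
      exp (Real.pi * I * (τ / 2 - 2 * w)) := by
    rw [← exp_add]; congr 1; ring
  rw [← h]
  ring_nf
  rw [I_sq]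
  ring

/-! ### Identities for the elliptic number. -/

theorem theta1_neg (u τ : ℂ) : theta1 (-u) τ = -theta1 u τ := by
  simp [theta1]

theorem br_neg (τ r u : ℂ) : br τ r (-u) = -br τ r u := by
  rw [br, neg_div, theta1_neg, br]; ring

theorem br_zero (τ r : ℂ) : br τ r 0 = 0 := by
  have := br_neg τ r 0
  rw [neg_zero] at this
  exact self_eq_neg.1 this

theorem br_mul_br {τ : ℂ} (hτ : 0 < τ.im) (r w z : ℂ) :
    constC τ r ^ 2 * (theta3 (w / (2 * r)) (τ / 2) * theta0 (z / (2 * r)) (τ / 2) -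
      theta0 (w / (2 * r)) (τ / 2) * theta3 (z / (2 * r)) (τ / 2)) =
      -2 * (br τ r ((w + z) / 2) * br τ r ((w - z) / 2)) := by
  rw [theta3_mul_theta0_sub _ _ hτ, br, br, ← add_div, ← sub_div, div_div, div_div]
  ring

/-- The three-term identity of Weierstrass. -/
theorem br_three_term {τ : ℂ} (hτ : 0 < τ.im) (r x y z w : ℂ) :
    br τ r (x + y) * br τ r (x - y) * (br τ r (z + w) * br τ r (z - w)) -
      br τ r (x + z) * br τ r (x - z) * (br τ r (y + w) * br τ r (y - w)) +
      br τ r (x + w) * br τ r (x - w) * (br τ r (y + z) * br τ r (y - z)) = 0 := by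
  -- Each `[a+b][a-b]` is a multiple of the determinant of the vectors `(ϑ₃, ϑ₀)` at `a` and `b`.
  -- The claim is then the Plücker relation for four vectors in a plane.
  have h : ∀ a b : ℂ, br τ r (a + b) * br τ r (a - b) = -(1 / 2) * (constC τ r ^ 2 *
      (theta3 (2 * a / (2 * r)) (τ / 2) * theta0 (2 * b / (2 * r)) (τ / 2) -
      theta0 (2 * a / (2 * r)) (τ / 2) * theta3 (2 * b / (2 * r)) (τ / 2))) := by
    intro a b
    rw [br_mul_br hτ, show (2 * a + 2 * b) / 2 = a + b by ring,
      show (2 * a - 2 * b) / 2 = a - b by ring]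
    ring
  simp only [h]
  ring

/-! ### Paths of heights -/

theorem height_zero {k : ℕ} (a : ℤ) (e : Fin k → ℤˣ) : height a e 0 = a := by
  simp [height]

theorem height_cons {k : ℕ} (a : ℤ) (x : ℤˣ) (e : Fin k → ℤˣ) (i : ℕ) :
    height a (Fin.cons x e : Fin (k + 1) → ℤˣ) (i + 1) = height (a + x) e i := by
  simp [height, Fin.sum_univ_succ, add_assoc]

theorem height_snoc {k : ℕ} (a : ℤ) (x : ℤˣ) (e : Fin k → ℤˣ) {i : ℕ} (hi : i ≤ k) :
    height a (Fin.snoc e x : Fin (k + 1) → ℤˣ) i = height a e i := by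
  simp [height, Fin.sum_univ_castSucc, Nat.not_lt.2 hi]

theorem height_snoc_last {k : ℕ} (a : ℤ) (x : ℤˣ) (e : Fin k → ℤˣ) :
    height a (Fin.snoc e x : Fin (k + 1) → ℤˣ) (k + 1) = a + ∑ i, (e i : ℤ) + x := by
  simp only [height, Fin.sum_univ_castSucc, Fin.snoc_castSucc, Fin.snoc_last, Fin.val_castSucc,
    Fin.val_last, Nat.lt_succ_self, if_true]
  rw [sum_congr rfl fun i _ => if_pos (by omega), add_assoc]

theorem height_self {k : ℕ} (a : ℤ) (e : Fin k → ℤˣ) : height a e k = a + ∑ i, (e i : ℤ) := by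
  simp [height]

theorem height_succ {k : ℕ} (a : ℤ) (e : Fin k → ℤˣ) (i : Fin k) :
    height a e (i + 1) = height a e i + e i := by
  have h : ∀ j : Fin k, (if (j : ℕ) < i + 1 then (e j : ℤ) else 0) =
      (if (j : ℕ) < i then (e j : ℤ) else 0) + if j = i then (e j : ℤ) else 0 := by
    intro j
    rcases lt_trichotomy (j : ℕ) i with hji | hji | hji
    · have : j ≠ i := fun h => by simp [h] at hji
      simp [hji, this]; omega
    · have : j = i := Fin.ext hji
      simp [this]
    · have : j ≠ i := fun h => by simp [h] at hji
      rw [if_neg (by omega), if_neg (by omega), if_neg this, add_zero]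
  simp only [height, h, sum_add_distrib, sum_ite_eq', mem_univ, if_true, add_assoc]

theorem height_neg_one {k : ℕ} (a : ℤ) {i : ℕ} (hi : i ≤ k) :
    height a (fun _ : Fin k => (-1 : ℤˣ)) i = a - i := by
  induction i with
  | zero => simp [height_zero]
  | succ i ih =>
    have := height_succ a (fun _ : Fin k => (-1 : ℤˣ)) ⟨i, hi⟩
    simp only at this
    rw [this, ih (by omega)]
    push_cast; ring

theorem mem_signs {k : ℕ} {ε : ℤ} {e : Fin k → ℤˣ} : e ∈ signs k ε ↔ ∑ i, (e i : ℤ) = ε := by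
  simp [signs]

theorem mem_weights {k : ℕ} {ε : ℤ} :
    ε ∈ weights k ↔ ∃ j : ℕ, j ≤ k ∧ (k : ℤ) - 2 * j = ε := by
  simp [weights]

theorem val_eq_one_sub (x : ℤˣ) : (x : ℤ) = 1 - 2 * if x = -1 then 1 else 0 := by
  rcases Int.units_eq_one_or x with rfl | rfl <;> simp

theorem sum_eq_sub_card {k : ℕ} (e : Fin k → ℤˣ) :
    ∑ i, (e i : ℤ) = k - 2 * #{i | e i = -1} := by
  rw [sum_congr rfl fun i _ => val_eq_one_sub (e i), sum_sub_distrib, ← mul_sum]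
  simp

theorem sum_mem_weights {k : ℕ} (e : Fin k → ℤˣ) : ∑ i, (e i : ℤ) ∈ weights k :=
  mem_weights.2 ⟨#{i | e i = -1}, by simpa using card_filter_le univ fun i => e i = -1,
    (sum_eq_sub_card e).symm⟩

theorem abs_sum_le {k : ℕ} (e : Fin k → ℤˣ) : |∑ i, (e i : ℤ)| ≤ k := by
  obtain ⟨j, hj, h⟩ := mem_weights.1 (sum_mem_weights e)
  rw [← h, abs_le]
  omega

theorem signs_neg_self (k : ℕ) : signs k (-k) = {fun _ => -1} := by
  ext e
  rw [mem_signs, mem_singleton]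
  constructor
  · intro h
    rw [sum_eq_sub_card] at h
    have h1 : #{i | e i = -1} = #(univ : Finset (Fin k)) := by simp; omega
    have h2 := card_filter_eq_iff.1 h1
    funext i
    exact h2 i (mem_univ i)
  · rintro rfl
    simp

theorem signs_eq_empty {k : ℕ} {ε : ℤ} (h : k < |ε|) : signs k ε = ∅ := by
  rw [eq_empty_iff_forall_notMem]
  intro e he
  have := abs_sum_le e
  rw [mem_signs.1 he] at this
  omega

theorem sum_signs_cons {k : ℕ} (ε : ℤ) (F : (Fin (k + 1) → ℤˣ) → ℂ) :
    ∑ e ∈ signs (k + 1) ε, F e =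
      ∑ x : ℤˣ, ∑ e ∈ signs k (ε - x), F (Fin.cons x e : Fin (k + 1) → ℤˣ) := by
  simp only [signs, sum_filter]
  rw [← (Fin.consEquiv fun _ => ℤˣ).sum_comp, Fintype.sum_prod_type]
  refine sum_congr rfl fun x _ => sum_congr rfl fun e _ => ?_
  simp [Fin.consEquiv, Fin.sum_univ_succ, eq_sub_iff_add_eq, add_comm]

theorem sum_signs_snoc {k : ℕ} (ε : ℤ) (F : (Fin (k + 1) → ℤˣ) → ℂ) :
    ∑ e ∈ signs (k + 1) ε, F e =
      ∑ x : ℤˣ, ∑ e ∈ signs k (ε - x), F (Fin.snoc e x : Fin (k + 1) → ℤˣ) := by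
  simp only [signs, sum_filter]
  rw [← (Fin.snocEquiv fun _ => ℤˣ).sum_comp, Fintype.sum_prod_type]
  refine sum_congr rfl fun x _ => sum_congr rfl fun e _ => ?_
  simp [Fin.snocEquiv, Fin.sum_univ_castSucc, eq_sub_iff_add_eq]

theorem sum_units (f : ℤˣ → ℂ) : ∑ x, f x = f 1 + f (-1) := by
  rw [show (univ : Finset ℤˣ) = {1, -1} from rfl, sum_pair (by decide)]

/-- A symmetric product over a sign sequence depends only on the sum of the signs. -/
theorem prod_eq_of_mem_signs {k : ℕ} {ε : ℤ} {e e' : Fin k → ℤˣ} (h : e ∈ signs k ε)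
    (h' : e' ∈ signs k ε) (f : ℤˣ → ℂ) : ∏ i, f (e i) = ∏ i, f (e' i) := by
  have key : ∀ e : Fin k → ℤˣ, ∏ i, f (e i) =
      f (-1) ^ #{i | e i = -1} * f 1 ^ (k - #{i | e i = -1}) := by
    intro e
    rw [prod_congr rfl fun i _ => show f (e i) = if e i = -1 then f (-1) else f 1 by
      rcases Int.units_eq_one_or (e i) with h | h <;> simp [h], prod_ite, prod_const, prod_const]
    congr 2
    have := card_filter_add_card_filter_not (s := (univ : Finset (Fin k))) fun i => e i = -1
    simp only [card_univ, Fintype.card_fin] at this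
    omega
  have hc : #{i | e i = -1} = #{i | e' i = -1} := by
    have h1 := mem_signs.1 h
    have h2 := mem_signs.1 h'
    rw [sum_eq_sub_card] at h1 h2
    omega
  rw [key, key, hc]

/-- The number of steps `x` among the first `i` ones. -/
def stepCount {k : ℕ} (e : Fin k → ℤˣ) (x : ℤˣ) (i : ℕ) : ℕ :=
  ∑ j : Fin k, if (j : ℕ) < i ∧ e j = x then 1 else 0

theorem stepCount_snoc {k : ℕ} (e : Fin k → ℤˣ) (x y : ℤˣ) {i : ℕ} (hi : i ≤ k) :
    stepCount (Fin.snoc e x : Fin (k + 1) → ℤˣ) y i = stepCount e y i := by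
  simp [stepCount, Fin.sum_univ_castSucc, Nat.not_lt.2 hi, -sum_boole]

theorem stepCount_snoc_last {k : ℕ} (e : Fin k → ℤˣ) (x y : ℤˣ) :
    stepCount (Fin.snoc e x : Fin (k + 1) → ℤˣ) y (k + 1) =
      stepCount e y k + if x = y then 1 else 0 := by
  simp [stepCount, Fin.sum_univ_castSucc, -sum_boole]

/-- A product over a path of factors that are numbered separately for the two kinds of steps. -/
theorem prod_stepCount {k : ℕ} (e : Fin k → ℤˣ) (A B : ℕ → ℂ) :
    ∏ i : Fin k, (if e i = 1 then A (stepCount e 1 i) else B (stepCount e (-1) i)) =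
      (∏ p ∈ range (stepCount e 1 k), A p) * ∏ m ∈ range (stepCount e (-1) k), B m := by
  induction k with
  | zero => simp [stepCount]
  | succ k ih =>
    obtain ⟨e, x, rfl⟩ : ∃ (e' : Fin k → ℤˣ) (x : ℤˣ), e = (Fin.snoc e' x : Fin (k + 1) → ℤˣ) :=
      ⟨Fin.init e, e (Fin.last k), (Fin.snoc_init_self e).symm⟩
    rw [Fin.prod_univ_castSucc, stepCount_snoc_last, stepCount_snoc_last]
    have h : ∀ i : Fin k, (i : ℕ) ≤ k := fun i => i.2.le
    simp only [Fin.snoc_castSucc, Fin.snoc_last, Fin.val_castSucc, Fin.val_last,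
      stepCount_snoc _ _ _ (h _), stepCount_snoc _ _ _ le_rfl, ih]
    rcases Int.units_eq_one_or x with rfl | rfl
    · simp [prod_range_succ]; ring
    · simp [prod_range_succ]; ring

theorem stepCount_add {k : ℕ} (e : Fin k → ℤˣ) {i : ℕ} (hi : i ≤ k) :
    stepCount e 1 i + stepCount e (-1) i = i := by
  have h1 : ∀ j : Fin k, (if (j : ℕ) < i ∧ e j = 1 then 1 else 0) +
      (if (j : ℕ) < i ∧ e j = -1 then 1 else 0) = if (j : ℕ) < i then 1 else 0 := by
    intro j
    rcases Int.units_eq_one_or (e j) with h | h <;> simp [h]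
  rw [stepCount, stepCount, ← sum_add_distrib, sum_congr rfl fun j _ => h1 j,
    Fin.sum_univ_eq_sum_range (fun j => if j < i then 1 else 0) k, ← card_filter,
    show (range k).filter (· < i) = range i by ext j; simp; omega, card_range]

theorem height_eq_stepCount {k : ℕ} (a : ℤ) (e : Fin k → ℤˣ) (i : ℕ) :
    height a e i = a + stepCount e 1 i - stepCount e (-1) i := by
  have h1 : ∀ j : Fin k, (if (j : ℕ) < i then (e j : ℤ) else 0) =
      (if (j : ℕ) < i ∧ e j = 1 then (1 : ℤ) else 0) -
      (if (j : ℕ) < i ∧ e j = -1 then 1 else 0) := by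
    intro j
    rcases Int.units_eq_one_or (e j) with h | h <;> simp [h]
    split_ifs <;> rfl
  rw [height, sum_congr rfl fun j _ => h1 j, sum_sub_distrib, stepCount, stepCount]
  push_cast
  ring

/-! ### The `L`-matrix as a product -/

theorem psi_one (τ r u : ℂ) (a b : ℤ) :
    psi τ r 1 u a b = theta0 ((((a - b : ℤ) : ℂ) * u + a) / (2 * r)) (τ / 2) := if_pos rfl

theorem psi_neg_one (τ r u : ℂ) (a b : ℤ) :
    psi τ r (-1) u a b = theta3 ((((a - b : ℤ) : ℂ) * u + a) / (2 * r)) (τ / 2) :=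
  if_neg (by decide)

/-- For a descending path all the dual intertwining vectors have the same argument. -/
theorem psiStar_sub_one (τ r : ℂ) (x : ℤˣ) (u : ℂ) (b : ℤ) :
    psiStar τ r x u (b - 1) b =
      (((x : ℤ) : ℂ) * if x = 1 then theta3 (((b : ℂ) - u) / (2 * r)) (τ / 2)
        else theta0 (((b : ℂ) - u) / (2 * r)) (τ / 2)) *
      (constC τ r ^ 2 / (2 * (br τ r b * br τ r u))) := by
  have h : ((b - 1 - b : ℤ) : ℂ) * (u - 1) + ((b - 1 : ℤ) : ℂ) = b - u := by push_cast; ring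
  rw [psiStar]
  rcases Int.units_eq_one_or x with rfl | rfl
  · rw [psi_neg_one, h, if_pos rfl]
    push_cast; ring
  · rw [neg_neg, psi_one, h, if_neg (by decide)]
    push_cast; ring

/-- The numerator of a factor of the `L`-matrix, for a path `e` from `n`. -/
theorem theta_sum_step {τ : ℂ} (hτ : 0 < τ.im) (r u : ℂ) (n : ℤ) {k : ℕ} (e : Fin k → ℤˣ)
    (i : Fin k) :
    constC τ r ^ 2 * ∑ x : ℤˣ, (((x : ℤ) : ℂ) *
      if x = 1 then theta3 (((n : ℂ) + k - u) / (2 * r)) (τ / 2)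
        else theta0 (((n : ℂ) + k - u) / (2 * r)) (τ / 2)) *
      psi τ r x (u + k - (i : ℕ)) (height n e i) (height n e (i + 1)) =
    -2 * if e i = 1 then br τ r (n + stepCount e 1 i - u) * br τ r (k - stepCount e 1 i)
      else br τ r (n + k - stepCount e (-1) i) * br τ r (stepCount e (-1) i - u) := by
  have hi : ((i : ℕ) : ℂ) = stepCount e 1 i + stepCount e (-1) i := by
    exact_mod_cast (stepCount_add e i.2.le).symm
  have hh : ((height n e i : ℤ) : ℂ) = n + stepCount e 1 i - stepCount e (-1) i := by
    rw [height_eq_stepCount]; push_cast; ring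
  rw [sum_units, psi_one, psi_neg_one, if_pos rfl, if_neg (by decide)]
  set z : ℂ := ((height n e i - height n e (i + 1) : ℤ) : ℂ) * (u + k - (i : ℕ)) +
    (height n e i : ℤ) with hz
  have h1 := br_mul_br hτ r ((n : ℂ) + k - u) z
  have h2 : ∀ A B : ℂ, (((1 : ℤˣ) : ℤ) : ℂ) * A + (((-1 : ℤˣ) : ℤ) : ℂ) * B = A - B := by
    intro A B; push_cast; ring
  rw [mul_assoc, mul_assoc, h2, h1]
  congr 1
  rcases Int.units_eq_one_or (e i) with he | he
  · have hz' : z = n + stepCount e 1 i - stepCount e (-1) i - (u + k - (i : ℕ)) := by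
      rw [hz, height_succ, he]; push_cast; rw [hh]; ring
    rw [if_pos he, hz', hi]
    congr 2 <;> ring
  · have hz' : z = n + stepCount e 1 i - stepCount e (-1) i + (u + k - (i : ℕ)) := by
      rw [hz, height_succ, he]; push_cast; rw [hh]; ring
    rw [if_neg (by rw [he]; decide), hz', hi]
    congr 2 <;> ring

/-- By `theta_sum_step` the numerator at a step depends only on its direction and on how many
earlier steps went the same way. Hence the product depends on the path only through its numbers `k -
s` and `s` of ascents and descents. -/
theorem Lmat_eq_prod {τ : ℂ} (hτ : 0 < τ.im) (r u : ℂ) {k : ℕ} {P : ℤ → ℤ → Fin k → ℤˣ}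
    {E : ℤ → Fin k → ℤˣ} (hP : IsPathChoice P) (hE : IsSignChoice E) (n : ℤ) {s : ℕ} (hs : s ≤ k) :
    Lmat τ r P E n (n + k - 2 * s) (n + 2 * k) (n + k) (u + 1) =
      (-1) ^ k * ((∏ p ∈ range (k - s), br τ r (n + p - u) * br τ r (k - p)) *
        (∏ m ∈ range s, br τ r (n + k - m) * br τ r (m - u)) /
        ∏ i ∈ range k, br τ r (n + 2 * k - i) * br τ r (u + k - i)) := by
  have hw : n + k - 2 * s - n ∈ weights k := mem_weights.2 ⟨s, hs, by ring⟩
  set e := P n (n + k - 2 * s) with he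
  have hes : ∑ i, (e i : ℤ) = n + k - 2 * s - n := mem_signs.1 (hP _ _ hw)
  set f : ℤˣ → ℂ := fun x => ((x : ℤ) : ℂ) *
      if x = 1 then theta3 (((n : ℂ) + k - u) / (2 * r)) (τ / 2)
        else theta0 (((n : ℂ) + k - u) / (2 * r)) (τ / 2) with hf
  set K : Fin k → ℂ := fun i => constC τ r ^ 2 /
    (2 * (br τ r (n + 2 * k - (i : ℕ)) * br τ r (u + k - (i : ℕ)))) with hK
  set ps : Fin k → ℤˣ → ℂ := fun i x =>
    psi τ r x (u + k - (i : ℕ)) (height n e i) (height n e (i + 1)) with hps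
  have hstar : ∀ ε, psiStarK τ r E ε (u + 1) (n + k) (n + 2 * k) =
      (∏ i, f (E ε i)) * ∏ i, K i := by
    intro ε
    rw [psiStarK, show n + k - (n + 2 * k) = -(k : ℤ) by ring, signs_neg_self, sum_singleton,
      ← prod_mul_distrib]
    refine prod_congr rfl fun i _ => ?_
    rw [height_neg_one _ i.2.le, height_neg_one _ (Nat.succ_le_of_lt i.2),
      show n + 2 * k - ((i + 1 : ℕ) : ℤ) = n + 2 * k - (i : ℕ) - 1 by push_cast; ring,
      psiStar_sub_one, hf, hK]
    dsimp only
    push_cast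
    rw [show (n : ℂ) + 2 * k - (i : ℕ) - (u + 1 + k - 1 - (i : ℕ)) = n + k - u by ring,
      show u + 1 + k - 1 - ((i : ℕ) : ℂ) = u + k - (i : ℕ) by ring]
  have hpsi : ∀ ε, psiK τ r P ε (u + 1) n (n + k - 2 * s) =
      ∑ x ∈ signs k ε, ∏ i, ps i (x i) := by
    intro ε
    rw [psiK, if_pos hw]
    refine sum_congr rfl fun x _ => prod_congr rfl fun i _ => ?_
    rw [hps]; dsimp only
    rw [show u + 1 + k - 1 - ((i : ℕ) : ℂ) = u + k - (i : ℕ) by ring]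
  -- The product of the `f (E ε i)` depends only on `ε`, so the chosen signs may be replaced by
  -- those summed over in `psiK`. The sums over `ε` and over sign sequences of sum `ε` then merge
  -- into one unrestricted sum, which factorises.
  have hL : Lmat τ r P E n (n + k - 2 * s) (n + 2 * k) (n + k) (u + 1) =
      (∏ i, K i) * ∏ i, ∑ x : ℤˣ, f x * ps i x := by
    rw [Lmat, prod_univ_sum, Fintype.piFinset_univ,
      ← sum_fiberwise_of_maps_to (g := fun x : Fin k → ℤˣ => ∑ i, (x i : ℤ))
        (fun x _ => sum_mem_weights x), mul_sum]
    refine sum_congr rfl fun ε hε => ?_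
    rw [hstar, hpsi, mul_comm (∏ i, f (E ε i)), mul_assoc, mul_sum]
    congr 1
    refine sum_congr rfl fun x hx => ?_
    rw [prod_eq_of_mem_signs (hE ε hε) hx f, ← prod_mul_distrib]
  have hcount := height_eq_stepCount n e k
  have hadd := stepCount_add e le_rfl
  rw [height_self, hes] at hcount
  have h1 : stepCount e 1 k = k - s := by omega
  have h2 : stepCount e (-1) k = s := by omega
  have hfac : ∀ i : Fin k, K i * ∑ x : ℤˣ, f x * ps i x =
      -1 * ((if e i = 1 then br τ r (n + stepCount e 1 i - u) * br τ r (k - stepCount e 1 i)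
      else br τ r (n + k - stepCount e (-1) i) * br τ r (stepCount e (-1) i - u)) *
      (br τ r (n + 2 * k - (i : ℕ)) * br τ r (u + k - (i : ℕ)))⁻¹) := by
    intro i
    have h := theta_sum_step hτ r u n e i
    rw [hK]; dsimp only
    rw [div_mul_eq_mul_div, h]
    rw [div_eq_mul_inv, mul_inv]
    ring
  rw [hL, ← prod_mul_distrib, prod_congr rfl fun i _ => hfac i, prod_mul_distrib,
    prod_mul_distrib, prod_const, card_univ, Fintype.card_fin,
    prod_stepCount e (fun p : ℕ => br τ r (n + p - u) * br τ r (k - p))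
      (fun m : ℕ => br τ r (n + k - m) * br τ r (m - u)), h1, h2,
    Fin.prod_univ_eq_prod_range (fun i : ℕ =>
      (br τ r (n + 2 * k - i) * br τ r (u + k - i))⁻¹) k, prod_inv_distrib, div_eq_mul_inv]

/-! ### The `k × 1` fusion as a product -/

/-- The twelve arguments are free variables, so that each instance reduces to linear equations. -/
theorem br_three_term_of_eq {τ : ℂ} (hτ : 0 < τ.im) (r x y z w : ℂ)
    {a₁ a₂ a₃ a₄ b₁ b₂ b₃ b₄ c₁ c₂ c₃ c₄ : ℂ}
    (ha₁ : x + y = a₁) (ha₂ : x - y = a₂) (ha₃ : z + w = a₃) (ha₄ : z - w = a₄)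
    (hb₁ : x + z = b₁) (hb₂ : x - z = b₂) (hb₃ : y + w = b₃) (hb₄ : y - w = b₄)
    (hc₁ : x + w = c₁) (hc₂ : x - w = c₂) (hc₃ : y + z = c₃) (hc₄ : z - y = c₄) :
    br τ r a₁ * br τ r a₂ * (br τ r a₃ * br τ r a₄) =
      br τ r b₁ * br τ r b₂ * (br τ r b₃ * br τ r b₄) +
      br τ r c₁ * br τ r c₂ * (br τ r c₃ * br τ r c₄) := by
  have h := br_three_term hτ r x y z w
  rw [show y - z = -(z - y) by ring, br_neg, ha₁, ha₂, ha₃, ha₄, hb₁, hb₂, hb₃, hb₄, hc₁, hc₂, hc₃,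
    hc₄] at h
  linear_combination h

/-- This identity and `br_identity_down` are the induction steps of `faceSum_eq` for an upper path
beginning with an ascent or a descent. -/
theorem br_identity_up {τ : ℂ} (hτ : 0 < τ.im) (r a t x : ℂ) :
    br τ r x * br τ r a * br τ r (a + 1 - t) * br τ r (t + x + 1) +
      br τ r 1 * br τ r (a - t - x) * br τ r (a + 1 + x) * br τ r t =
    br τ r (x + 1) * br τ r (a + 1) * br τ r (a - t) * br τ r (t + x) := by
  have h := br_three_term_of_eq hτ r (x / 2 + 1 + a / 2) (x / 2 - a / 2) (a / 2 + x / 2)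
    (a / 2 - t - x / 2) (a₁ := x + 1) (a₂ := a + 1) (a₃ := a - t) (a₄ := t + x)
    (b₁ := a + 1 + x) (b₂ := 1) (b₃ := -t) (b₄ := -(a - t - x))
    (c₁ := a + 1 - t) (c₂ := t + x + 1) (c₃ := x) (c₄ := a)
    (by ring) (by ring) (by ring) (by ring) (by ring) (by ring) (by ring) (by ring) (by ring)
    (by ring) (by ring) (by ring)
  rw [br_neg, br_neg] at h
  linear_combination -h

theorem br_identity_down {τ : ℂ} (hτ : 0 < τ.im) (r a t x : ℂ) :
    br τ r a * br τ r (t + x + 1) * br τ r (a - 1 + x) * br τ r t +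
      br τ r (a + t + x) * br τ r 1 * br τ r x * br τ r (a - 1 - t) =
    br τ r (a + x) * br τ r (t + 1) * br τ r (a - 1) * br τ r (t + x) := by
  have h := br_three_term_of_eq hτ r (a / 2 + x / 2 + t / 2 + 1 / 2)
    (a / 2 + x / 2 - t / 2 - 1 / 2) (a / 2 - 1 / 2 + t / 2 + x / 2) (a / 2 - 1 / 2 - t / 2 - x / 2)
    (a₁ := a + x) (a₂ := t + 1) (a₃ := a - 1) (a₄ := t + x)
    (b₁ := a + t + x) (b₂ := 1) (b₃ := a - 1 - t) (b₄ := x)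
    (c₁ := a) (c₂ := t + x + 1) (c₃ := a - 1 + x) (c₄ := t)
    (by ring) (by ring) (by ring) (by ring) (by ring) (by ring) (by ring) (by ring) (by ring)
    (by ring) (by ring) (by ring)
  linear_combination -h

theorem face_of_ne (τ r : ℂ) {a b d c : ℤ} (u : ℂ) (h : |c - b| ≠ 1) : face τ r a b d c u = 0 :=
  if_neg fun h' => h h'.2.2.1

theorem face_diag (τ r : ℂ) (a : ℤ) (x : ℤˣ) (u : ℂ) :
    face τ r a (a + x) (a + x) (a + x + x) u = 1 := by
  rcases Int.units_eq_one_or x with rfl | rfl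
  · rw [face, if_pos (by simp), if_neg (by simp; omega)]
  · rw [face, if_pos (by simp), if_neg (by simp; omega)]

theorem face_eq (τ r : ℂ) (a : ℤ) (x : ℤˣ) (u : ℂ) :
    face τ r a (a + x) (a + x) a u =
      br τ r (a - ((x : ℤ) : ℂ) * u) * br τ r 1 / (br τ r a * br τ r (1 + u)) := by
  rw [face, if_pos (by rcases Int.units_eq_one_or x with rfl | rfl <;> simp), if_pos rfl,
    if_pos rfl, add_sub_cancel_left]

theorem face_ne (τ r : ℂ) (a : ℤ) (x : ℤˣ) (u : ℂ) :
    face τ r a (a + x) (a - x) a u =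
      br τ r ((a + x : ℤ) : ℂ) * br τ r u / (br τ r a * br τ r (1 + u)) := by
  rw [face, if_pos (by rcases Int.units_eq_one_or x with rfl | rfl <;> simp), if_pos rfl, if_neg]
  rcases Int.units_eq_one_or x with rfl | rfl
  · simp; omega
  · simp

/-- The sum over the lower paths from `d` to `c`, below the path from `a` with the steps `p`. -/
def faceSum (τ r : ℂ) {k : ℕ} (p : Fin k → ℤˣ) (a d c : ℤ) (u : ℂ) : ℂ :=
  ∑ e ∈ signs k (c - d), ∏ j : Fin k,
    face τ r (height a p j) (height a p (j + 1)) (height d e j) (height d e (j + 1))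
      (u + k - 1 - (j : ℕ))

theorem faceSum_zero (τ r : ℂ) (p : Fin 0 → ℤˣ) (a d c : ℤ) (u : ℂ) :
    faceSum τ r p a d c u = if d = c then 1 else 0 := by
  simp only [faceSum, signs, sum_filter, univ_unique, sum_singleton, univ_eq_empty, sum_empty,
    prod_empty]
  congr 1
  exact propext ⟨fun h => by omega, fun h => by omega⟩

theorem faceSum_cons (τ r : ℂ) {k : ℕ} (x : ℤˣ) (p : Fin k → ℤˣ) (a d c : ℤ) (u : ℂ) :
    faceSum τ r (Fin.cons x p : Fin (k + 1) → ℤˣ) a d c u =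
      ∑ y : ℤˣ, face τ r a (a + x) d (d + y) (u + k) * faceSum τ r p (a + x) (d + y) c u := by
  rw [faceSum, sum_signs_cons]
  refine sum_congr rfl fun y _ => ?_
  rw [faceSum, mul_sum, sub_sub]
  refine sum_congr rfl fun e _ => ?_
  rw [Fin.prod_univ_succ]
  simp only [Fin.val_zero, height_zero, Fin.val_succ, height_cons, zero_add]
  congr 2
  · push_cast; ring
  · funext j
    congr 1
    push_cast; ring

/-- Here `x` and `y` count the ascents and descents of the upper path; their order does not enter
the result. The two starting heights `a ± 1` of the lower path are treated together, since peeling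
off the first face couples them. The denominator is multiplied out because at `k = 0` it contains
`[u]`, which may vanish. -/
theorem faceSum_eq {τ : ℂ} (hτ : 0 < τ.im) (r u : ℂ) {k : ℕ} (p : Fin k → ℤˣ) (a x y : ℤ)
    (hxy : x + y = k) (hp : ∑ i, (p i : ℤ) = x - y)
    (hbr : ∀ h : ℤ, a - y ≤ h → h ≤ a + x → br τ r h ≠ 0)
    (hu : ∀ j : ℕ, 1 ≤ j → j ≤ k → br τ r (u + j) ≠ 0) :
    faceSum τ r p a (a - 1) (a + x - y - 1) u * (br τ r a * br τ r (u + k)) =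
        br τ r (a + x) * br τ r (u + y) ∧
      faceSum τ r p a (a + 1) (a + x - y - 1) u * (br τ r a * br τ r (u + k)) =
        br τ r x * br τ r (a - u - y) := by
  induction k generalizing a x y with
  | zero =>
    have hx : x = 0 := by simp at hp hxy; omega
    have hy : y = 0 := by simp at hp hxy; omega
    subst hx hy
    rw [faceSum_zero, faceSum_zero, if_pos (by ring), if_neg (by omega)]
    simp [br_zero]
  | succ k ih =>
    obtain ⟨p, s, rfl⟩ : ∃ (p' : Fin k → ℤˣ) (s : ℤˣ), p = (Fin.cons s p' : Fin (k + 1) → ℤˣ) :=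
      ⟨Fin.tail p, p 0, (Fin.cons_self_tail p).symm⟩
    have hpk := abs_le.1 (abs_sum_le p)
    rw [Fin.sum_univ_succ] at hp
    simp only [Fin.cons_zero, Fin.cons_succ] at hp
    rw [faceSum_cons, faceSum_cons, sum_units, sum_units]
    have hk1 : br τ r (1 + (u + k)) ≠ 0 := by
      have := hu (k + 1) (by omega) le_rfl
      rwa [show u + ((k + 1 : ℕ) : ℂ) = 1 + (u + k) by push_cast; ring] at this
    have hkk : u + ((k + 1 : ℕ) : ℂ) = 1 + (u + k) := by push_cast; ring
    have hkxy : (k : ℂ) = x + y - 1 := by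
      have : (k : ℤ) = x + y - 1 := by push_cast at hxy; omega
      exact_mod_cast this
    rcases Int.units_eq_one_or s with rfl | rfl
    · rw [Units.val_one] at hp
      have ha : br τ r a ≠ 0 := hbr a (by omega) (by omega)
      have ha1 : br τ r (a + 1 : ℤ) ≠ 0 := hbr _ (by omega) (by omega)
      obtain ⟨h1, h2⟩ := ih p (a + 1) (x - 1) y (by push_cast at hxy; omega) (by omega)
        (fun h h3 h4 => hbr h (by omega) (by omega)) (fun j h3 h4 => hu j h3 (by omega))
      have f1 := face_ne τ r a 1 (u + k)
      have f2 := face_diag τ r a 1 (u + k)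
      have f3 := face_eq τ r a 1 (u + k)
      -- The lower path cannot descend away from an ascending upper one, so the sum from `a - 1` has
      -- a single term; only the sum from `a + 1` needs the three-term identity. For a descent the
      -- roles are exchanged.
      have f4 : face τ r a (a + 1) (a - 1) (a - 1 + -1) (u + k) = 0 :=
        face_of_ne _ _ _ (by rw [show a - 1 + -1 - (a + 1) = -3 by ring]; decide)
      simp only [Units.val_one, Units.val_neg, Int.cast_one, one_mul] at f1 f2 f3 ⊢
      rw [show a + 1 + -1 = a by ring, show a - 1 + 1 = a by ring]
      rw [show a + 1 - 1 = a by ring, show a + 1 + (x - 1) - y - 1 = a + x - y - 1 by ring] at h1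
      rw [show a + 1 + (x - 1) - y - 1 = a + x - y - 1 by ring] at h2
      rw [f1, f2, f3, f4, hkk]
      push_cast at h1 h2 ha1 ⊢
      constructor
      · rw [zero_mul, add_zero, show (a : ℂ) + x = a + 1 + (x - 1) by ring, ← h1]
        field_simp
      -- For `k = 0` the induction hypothesis is multiplied by the possibly zero `[u]` and cannot be
      -- divided out, so the single face is computed directly.
      · rcases Nat.eq_zero_or_pos k with rfl | hk
        · have hx : x = 1 := by omega
          have hy : y = 0 := by omega
          subst hx hy
          rw [faceSum_zero, faceSum_zero, if_neg (by omega), if_pos (by omega)]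
          push_cast
          simp only [Nat.cast_zero, add_zero] at hk1
          simp only [add_zero, sub_zero]
          field_simp
          ring
        · have hk0 : br τ r (u + k) ≠ 0 := hu k hk (by omega)
          have hid := br_identity_up hτ r a (u + y) (x - 1)
          rw [show u + y + (x - 1) + 1 = 1 + (u + k) by rw [hkxy]; ring,
            show a - (u + y) - ((x : ℂ) - 1) = a - (u + k) by rw [hkxy]; ring,
            show u + y + ((x : ℂ) - 1) = u + k by rw [hkxy]; ring,
            show (a : ℂ) + 1 - (u + y) = a + 1 - u - y by ring,
            show (a : ℂ) - (u + y) = a - u - y by ring, show (x : ℂ) - 1 + 1 = x by ring] at hid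
          apply mul_right_cancel₀ (mul_ne_zero ha1 hk0)
          rw [show br τ r x * br τ r (a - u - y) * (br τ r (a + 1) * br τ r (u + k)) =
            br τ r x * br τ r (a + 1) * br τ r (a - u - y) * br τ r (u + k) by ring, ← hid]
          field_simp
          linear_combination (br τ r a * br τ r (1 + (u + k))) * h2 +
            (br τ r (a - (u + k)) * br τ r 1) * h1
    · rw [Units.val_neg, Units.val_one] at hp
      have ha : br τ r a ≠ 0 := hbr a (by omega) (by omega)
      have ha1 : br τ r (a - 1 : ℤ) ≠ 0 := hbr _ (by omega) (by omega)
      obtain ⟨h1, h2⟩ := ih p (a - 1) x (y - 1) (by push_cast at hxy; omega) (by omega)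
        (fun h h3 h4 => hbr h (by omega) (by omega)) (fun j h3 h4 => hu j h3 (by omega))
      have f1 := face_ne τ r a (-1) (u + k)
      have f2 := face_diag τ r a (-1) (u + k)
      have f3 := face_eq τ r a (-1) (u + k)
      have f4 : face τ r a (a - 1) (a + 1) (a + 1 + 1) (u + k) = 0 :=
        face_of_ne _ _ _ (by rw [show a + 1 + 1 - (a - 1) = 3 by ring]; decide)
      simp only [Units.val_one, Units.val_neg, Int.cast_one, Int.cast_neg, ← sub_eq_add_neg,
        sub_neg_eq_add, neg_mul, one_mul] at f1 f2 f3 ⊢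
      rw [show a + 1 - 1 = a by ring, show a - 1 + 1 = a by ring]
      rw [show a - 1 + 1 = a by ring, show a - 1 + x - (y - 1) - 1 = a + x - y - 1 by ring] at h2
      rw [show a - 1 + x - (y - 1) - 1 = a + x - y - 1 by ring] at h1
      rw [f1, f2, f3, f4, hkk]
      push_cast at h1 h2 ha1 ⊢
      constructor
      · rcases Nat.eq_zero_or_pos k with rfl | hk
        · have hx : x = 0 := by omega
          have hy : y = 1 := by omega
          subst hx hy
          rw [faceSum_zero, faceSum_zero, if_neg (by omega), if_pos (by omega)]
          push_cast
          simp only [add_zero]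
          rw [add_comm u 1]
          ring
        · have hk0 : br τ r (u + k) ≠ 0 := hu k hk (by omega)
          have hid := br_identity_down hτ r a (u + (y - 1)) x
          rw [show u + (y - 1) + (x : ℂ) + 1 = 1 + (u + k) by rw [hkxy]; ring,
            show (a : ℂ) + (u + (y - 1)) + (x : ℂ) = a + (u + k) by rw [hkxy]; ring,
            show u + ((y : ℂ) - 1) + x = u + k by rw [hkxy]; ring,
            show u + ((y : ℂ) - 1) + 1 = u + y by ring,
            show (a : ℂ) - 1 - (u + (y - 1)) = a - 1 - u - (y - 1) by ring] at hid
          apply mul_right_cancel₀ (mul_ne_zero ha1 hk0)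
          rw [show br τ r (a + x) * br τ r (u + y) * (br τ r (a - 1) * br τ r (u + k)) =
            br τ r (a + x) * br τ r (u + y) * br τ r (a - 1) * br τ r (u + k) by ring, ← hid]
          field_simp
          linear_combination (br τ r a * br τ r (1 + (u + k))) * h1 +
            (br τ r (a + (u + k)) * br τ r 1) * h2
      · rw [zero_mul, zero_add, show (a : ℂ) - u - y = a - 1 - u - (y - 1) by ring, mul_comm (br τ r x)]
        rw [mul_comm] at h2
        field_simp
        linear_combination h2

theorem faceK1_eq_faceSum {τ r u : ℂ} {k : ℕ} (P : ℤ → ℤ → Fin k → ℤˣ) {a b : ℤ} (d c : ℤ)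
    (h : b - a ∈ weights k) : faceK1 τ r P a b d c u = faceSum τ r (P a b) a d c u :=
  if_pos h

theorem faceK1_eq {τ : ℂ} (hτ : 0 < τ.im) (r u : ℂ) {k : ℕ} {P : ℤ → ℤ → Fin k → ℤˣ}
    (hP : IsPathChoice P) (a x y : ℤ) (hx : 0 ≤ x) (hy : 0 ≤ y) (hxy : x + y = k) (hk : 1 ≤ k)
    (hbr : ∀ h : ℤ, a - y ≤ h → h ≤ a + x → br τ r h ≠ 0)
    (hu : ∀ j : ℕ, 1 ≤ j → j ≤ k → br τ r (u + j) ≠ 0) :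
    faceK1 τ r P a (a + x - y) (a - 1) (a + x - y - 1) u =
        br τ r (a + x) * br τ r (u + y) / (br τ r a * br τ r (u + k)) ∧
      faceK1 τ r P a (a + x - y) (a + 1) (a + x - y - 1) u =
        br τ r x * br τ r (a - u - y) / (br τ r a * br τ r (u + k)) := by
  have hw : a + x - y - a ∈ weights k := mem_weights.2 ⟨y.toNat, by omega, by omega⟩
  rw [faceK1_eq_faceSum _ _ _ hw, faceK1_eq_faceSum _ _ _ hw]
  have h0 : br τ r a * br τ r (u + k) ≠ 0 :=
    mul_ne_zero (hbr a (by omega) (by omega)) (hu k hk le_rfl)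
  rw [eq_div_iff h0, eq_div_iff h0]
  refine faceSum_eq hτ r u _ a x y hxy ?_ hbr hu
  rw [mem_signs.1 (hP _ _ hw)]
  ring

/-! ### The `k × k` fusion as a product -/

/-- The sum over the paths of `j` steps from `n` to `n + x` of the products of the weights `w`. -/
def pathSum (w : ℕ → ℤ → ℤ → ℂ) (n : ℤ) (j : ℕ) (x : ℤ) : ℂ :=
  ∑ e ∈ signs j x, ∏ i : Fin j, w i (height n e i) (height n e (i + 1))

theorem pathSum_zero (w : ℕ → ℤ → ℤ → ℂ) (n : ℤ) : pathSum w n 0 0 = 1 := by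
  simp [pathSum, signs]

theorem pathSum_of_lt (w : ℕ → ℤ → ℤ → ℂ) (n : ℤ) {j : ℕ} {x : ℤ} (h : j < |x|) :
    pathSum w n j x = 0 := by
  rw [pathSum, signs_eq_empty h, sum_empty]

theorem pathSum_succ (w : ℕ → ℤ → ℤ → ℂ) (n : ℤ) (j : ℕ) (x : ℤ) :
    pathSum w n (j + 1) x = pathSum w n j (x - 1) * w j (n + x - 1) (n + x) +
      pathSum w n j (x + 1) * w j (n + x + 1) (n + x) := by
  have h : pathSum w n (j + 1) x =
      ∑ y : ℤˣ, pathSum w n j (x - y) * w j (n + x - y) (n + x) := by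
    rw [pathSum, sum_signs_snoc]
    refine sum_congr rfl fun y _ => ?_
    rw [pathSum, sum_mul]
    refine sum_congr rfl fun e he => ?_
    have hi : ∀ i : Fin j, (i : ℕ) ≤ j := fun i => i.2.le
    have hi' : ∀ i : Fin j, (i : ℕ) + 1 ≤ j := fun i => i.2
    rw [Fin.prod_univ_castSucc]
    simp only [Fin.val_castSucc, Fin.val_last, height_snoc _ _ _ (hi _), height_snoc _ _ _ (hi' _),
      height_snoc _ _ _ le_rfl]
    rw [height_snoc_last, height_self, mem_signs.1 he]
    congr 2 <;> ring
  rw [h, sum_units]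
  simp

/-- What remains of the recursion for `rowProd` after the common factors are cancelled. -/
theorem br_identity_rows {τ : ℂ} (hτ : 0 < τ.im) (r n v U D : ℂ) :
    br τ r (U + D + 2) * br τ r (n - D - 1 - v - U) * br τ r (v + U + 1 + D) * br τ r (n + U - D) =
      br τ r (U + 1) * br τ r (n + U + 1) * br τ r (v + U) * br τ r (n - v - U - 2 * D - 2) +
      br τ r (D + 1) * br τ r (n - D - 1) * br τ r (n - D - v) * br τ r (v + 2 * U + D + 2) := by
  have h := br_three_term_of_eq hτ r (1 / 2 + n / 2 - v / 2) (U + D + 3 / 2 - n / 2 + v / 2)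
    (v / 2 + U + 1 / 2 + n / 2) (v / 2 + 1 / 2 + D - n / 2) (a₁ := U + D + 2)
    (a₂ := n - D - 1 - v - U) (a₃ := v + U + 1 + D) (a₄ := n + U - D)
    (b₁ := n + U + 1) (b₂ := -(v + U)) (b₃ := -(n - v - U - 2 * D - 2)) (b₄ := U + 1)
    (c₁ := D + 1) (c₂ := n - D - v) (c₃ := v + 2 * U + D + 2) (c₄ := n - D - 1)
    (by ring) (by ring) (by ring) (by ring) (by ring) (by ring) (by ring) (by ring) (by ring)
    (by ring) (by ring) (by ring)
  rw [br_neg, br_neg] at h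
  linear_combination h

/-- The elliptic factorial `[1][2]⋯[m]`. -/
def brFact (τ r : ℂ) (m : ℕ) : ℂ := ∏ i ∈ range m, br τ r ((i : ℂ) + 1)

theorem brFact_succ (τ r : ℂ) (m : ℕ) :
    brFact τ r (m + 1) = brFact τ r m * br τ r ((m : ℂ) + 1) := prod_range_succ _ _

/-- The partial `k × (U + D)` fusion, where the left path has `U` ascents and `D` descents. -/
def rowProd (τ r : ℂ) (k n v : ℂ) (U D : ℕ) : ℂ :=
  brFact τ r (U + D) / (brFact τ r U * brFact τ r D) *
    ((∏ i ∈ range U, br τ r (k - i)) * (∏ i ∈ range U, br τ r (n - D - v - i)) *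
      (∏ i ∈ range D, br τ r (n + k - i)) * (∏ i ∈ range D, br τ r (v + U + i))) /
    ((∏ i ∈ range (U + D), br τ r (v + k + i)) * ∏ i ∈ range (U + D + 1), br τ r (n - D + i)) *
    br τ r (n + U - D)

/-- The weight of a row that begins with an ascent. -/
def rowUp (τ r : ℂ) (k n v : ℂ) (U D : ℕ) : ℂ :=
  br τ r (k - U) * br τ r (n - v - U - 2 * D) / (br τ r (n + U - D) * br τ r (v + k + (U + D : ℕ)))

/-- The weight of a row that begins with a descent. -/
def rowDown (τ r : ℂ) (k n v : ℂ) (U D : ℕ) : ℂ :=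
  br τ r (n + k - D) * br τ r (v + 2 * U + D) / (br τ r (n + U - D) * br τ r (v + k + (U + D : ℕ)))

section rows

variable {τ r k n v : ℂ} {U D : ℕ}

theorem rowProd_succ_zero (h1 : br τ r (n + U) ≠ 0) (h2 : br τ r (n + U + 1) ≠ 0)
    (h3 : ∀ i ≤ U, br τ r ((i : ℂ) + 1) ≠ 0) :
    rowProd τ r k n v (U + 1) 0 = rowProd τ r k n v U 0 * rowUp τ r k n v U 0 := by
  have hq : ∀ i ≤ U + 1, brFact τ r i ≠ 0 := fun i hi =>
    prod_ne_zero_iff.2 fun j hj => h3 j (by have := mem_range.1 hj; omega)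
  have e1 := hq U (by omega)
  have e2 := hq (U + 1) le_rfl
  simp only [rowProd, rowUp, add_zero, prod_range_succ _ U, prod_range_succ _ (U + 1), brFact,
    range_zero, prod_empty, mul_one, Nat.cast_zero, sub_zero, Nat.cast_add, Nat.cast_one, mul_zero]
  simp only [brFact, prod_range_succ _ U] at e1 e2
  rw [div_self e1, div_self e2, show n + ((U : ℂ) + 1) = n + U + 1 by ring]
  field_simp

theorem rowProd_zero_succ (h1 : br τ r (n - D) ≠ 0) (h2 : br τ r (n - D - 1) ≠ 0)
    (h3 : ∀ i ≤ D, br τ r ((i : ℂ) + 1) ≠ 0) :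
    rowProd τ r k n v 0 (D + 1) = rowProd τ r k n v 0 D * rowDown τ r k n v 0 D := by
  have hq : ∀ i ≤ D + 1, brFact τ r i ≠ 0 := fun i hi =>
    prod_ne_zero_iff.2 fun j hj => h3 j (by have := mem_range.1 hj; omega)
  have e1 := hq D (by omega)
  have e2 := hq (D + 1) le_rfl
  simp only [rowProd, rowDown, zero_add, prod_range_succ _ D, prod_range_succ' _ (D + 1), brFact,
    range_zero, prod_empty, one_mul, Nat.cast_zero, add_zero, Nat.cast_add, Nat.cast_one, mul_zero]
  simp only [brFact, prod_range_succ _ D] at e1 e2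
  have h4 : ∀ i : ℕ, n - ((D : ℂ) + 1) + ((i : ℂ) + 1) = n - D + i := fun i => by ring
  simp only [h4]
  rw [div_self e1, div_self e2, show n - ((D : ℂ) + 1) = n - D - 1 by ring]
  field_simp

/-- An elliptic Pascal rule: the last row added begins with an ascent or with a descent. On the
boundary, with no descents or no ascents, only one predecessor exists and no theta identity is
needed. -/
theorem rowProd_succ_succ (hτ : 0 < τ.im)
    (h1 : ∀ i : ℤ, -(D + 1) ≤ i → i ≤ U + 1 → br τ r (n + i) ≠ 0)
    (h2 : ∀ i ≤ U + D + 1, br τ r ((i : ℂ) + 1) ≠ 0)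
    (h3 : ∀ i ≤ U + D + 1, br τ r (v + k + (i : ℕ)) ≠ 0) :
    rowProd τ r k n v (U + 1) (D + 1) =
      rowProd τ r k n v U (D + 1) * rowUp τ r k n v U (D + 1) +
      rowProd τ r k n v (U + 1) D * rowDown τ r k n v (U + 1) D := by
  have hq : ∀ i ≤ U + D + 1, brFact τ r i ≠ 0 := fun i hi =>
    prod_ne_zero_iff.2 fun j hj => h2 j (by have := mem_range.1 hj; omega)
  have e1 := hq U (by omega)
  have e2 := hq D (by omega)
  have e3 := h2 U (by omega)
  have e4 := h2 D (by omega)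
  have e5 : ∏ i ∈ range (U + D + 1), br τ r (v + k + i) ≠ 0 :=
    prod_ne_zero_iff.2 fun j hj => h3 j (by have := mem_range.1 hj; omega)
  have e6 := h3 (U + D + 1) le_rfl
  have e7 : ∏ i ∈ range (U + D + 1), br τ r (n - D + i) ≠ 0 :=
    prod_ne_zero_iff.2 fun j hj => by
      have := h1 (j - D) (by omega) (by have := mem_range.1 hj; omega)
      push_cast at this
      rwa [show n + ((j : ℂ) - D) = n - D + j by ring] at this
  have e8 : br τ r (n - D - 1) ≠ 0 := by
    have := h1 (-(D + 1)) le_rfl (by omega)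
    push_cast at this
    rwa [show n + -((D : ℂ) + 1) = n - D - 1 by ring] at this
  have e9 : br τ r (n + U + 1) ≠ 0 := by
    have := h1 (U + 1) (by omega) le_rfl
    push_cast at this
    rwa [show n + ((U : ℂ) + 1) = n + U + 1 by ring] at this
  have e10 : br τ r (n + U - D - 1) ≠ 0 := by
    have := h1 (U - (D + 1)) (by omega) (by omega)
    push_cast at this
    rwa [show n + ((U : ℂ) - (D + 1)) = n + U - D - 1 by ring] at this
  have e11 : br τ r (n + U + 1 - D) ≠ 0 := by
    have := h1 (U + 1 - D) (by omega) (by omega)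
    push_cast at this
    rwa [show n + ((U : ℂ) + 1 - D) = n + U + 1 - D by ring] at this
  have hid := br_identity_rows hτ r n v U D
  have s1 : ∀ i : ℕ, n - ((D : ℂ) + 1) + ((i : ℂ) + 1) = n - D + i := fun i => by ring
  have s2 : ∀ i : ℕ, n - (D : ℂ) - v - ((i : ℂ) + 1) = n - (D + 1) - v - i := fun i => by ring
  have s3 : ∀ i : ℕ, v + (U : ℂ) + ((i : ℂ) + 1) = v + (U + 1) + i := fun i => by ring
  -- The products in the three terms differ by single factors at their ends; `p1` to `p5` reduce
  -- them to common ranges, so that they can be treated as atoms.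
  have p1 : ∏ i ∈ range (U + 1), br τ r (n - D - v - i) =
      (∏ i ∈ range U, br τ r (n - (D + 1) - v - i)) * br τ r (n - D - v) := by
    rw [prod_range_succ']; push_cast; simp only [s2, sub_zero]
  have p2 : ∏ i ∈ range (D + 1), br τ r (v + U + i) =
      (∏ i ∈ range D, br τ r (v + (U + 1) + i)) * br τ r (v + U) := by
    rw [prod_range_succ']; push_cast; simp only [s3, add_zero]
  have p3 : ∏ i ∈ range (U + D + 1 + 1), br τ r (n - (D + 1) + i) =
      (∏ i ∈ range (U + D + 1), br τ r (n - D + i)) * br τ r (n - D - 1) := by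
    rw [prod_range_succ']; push_cast; simp only [s1, add_zero]
    rw [show n - ((D : ℂ) + 1) = n - D - 1 by ring]
  have p4 : ∏ i ∈ range (U + D + 1 + 1), br τ r (n - D + i) =
      (∏ i ∈ range (U + D + 1), br τ r (n - D + i)) * br τ r (n + U + 1) := by
    rw [prod_range_succ]; push_cast
    rw [show n - (D : ℂ) + (U + D + 1) = n + U + 1 by ring]
  have p5 : ∏ i ∈ range (U + D + 1 + 1 + 1), br τ r (n - (D + 1) + i) =
      (∏ i ∈ range (U + D + 1), br τ r (n - D + i)) * br τ r (n - D - 1) * br τ r (n + U + 1) := by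
    rw [prod_range_succ, p3, show n - ((D : ℂ) + 1) + (U + D + 1 + 1 : ℕ) = n + U + 1 by
      push_cast; ring]
  have t1 : U + 1 + (D + 1) = U + D + 1 + 1 := by ring
  have t2 : U + (D + 1) = U + D + 1 := by ring
  have t3 : U + 1 + D = U + D + 1 := by ring
  simp only [rowProd, rowUp, rowDown, t1, t2, t3]
  push_cast
  rw [p1, p2, p3, p4, p5, brFact_succ τ r U, brFact_succ τ r D, brFact_succ τ r (U + D + 1),
    prod_range_succ _ U, prod_range_succ _ U, prod_range_succ _ D, prod_range_succ _ D,
    prod_range_succ _ (U + D + 1)]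
  push_cast at e6 ⊢
  rw [show (U : ℂ) + D + 1 + 1 = U + D + 2 by ring,
    show n - ((D : ℂ) + 1) - v - U = n - D - 1 - v - U by ring,
    show v + ((U : ℂ) + 1) + D = v + U + 1 + D by ring,
    show n + ((U : ℂ) + 1) - (D + 1) = n + U - D by ring,
    show n + (U : ℂ) - (D + 1) = n + U - D - 1 by ring,
    show n + ((U : ℂ) + 1) - D = n + U + 1 - D by ring,
    show n - v - (U : ℂ) - 2 * (D + 1) = n - v - U - 2 * D - 2 by ring,
    show v + 2 * ((U : ℂ) + 1) + D = v + 2 * U + D + 2 by ring]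
  clear p1 p2 p3 p4 p5
  generalize (∏ i ∈ range (U + D + 1), br τ r (v + k + i)) = A1 at *
  generalize (∏ i ∈ range (U + D + 1), br τ r (n - D + i)) = A2 at *
  generalize (∏ i ∈ range U, br τ r (k - i)) = A3
  generalize (∏ i ∈ range U, br τ r (n - (D + 1) - v - i)) = A4
  generalize (∏ i ∈ range D, br τ r (n + k - i)) = A5
  generalize (∏ i ∈ range D, br τ r (v + (U + 1) + i)) = A6
  generalize br τ r (n - v - U - 2 * D - 2) = B1 at *
  generalize br τ r (v + 2 * U + D + 2) = B2 at *
  field_simp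
  linear_combination (brFact τ r (U + D + 1) * A3 * br τ r (k - U) * A4 * A5 *
    br τ r (n + k - D) * A6) * hid

end rows

/-- Induction on the number of rows, removing the last step of the left path. Since `D ≤ s`, no
height below `n - s` is met, which matches the nonvanishing assumed in (a). -/
theorem pathSum_eq_rowProd {τ : ℂ} (hτ : 0 < τ.im) {r v : ℂ} {k s : ℕ} {n : ℤ}
    {w : ℕ → ℤ → ℤ → ℂ}
    (hup : ∀ U D : ℕ, U + D < k → D ≤ s →
      w (U + D) (n + U - D) (n + U - D + 1) = rowUp τ r k n v U D)
    (hdown : ∀ U D : ℕ, U + D < k → D ≤ s →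
      w (U + D) (n + U - D) (n + U - D - 1) = rowDown τ r k n v U D)
    (h1 : ∀ a : ℤ, n - s ≤ a → a ≤ n + k → br τ r a ≠ 0)
    (h2 : ∀ i < k, br τ r ((i : ℂ) + 1) ≠ 0)
    (h3 : ∀ i < k, br τ r (v + k + (i : ℕ)) ≠ 0) (U D : ℕ) (hUD : U + D ≤ k) (hD : D ≤ s) :
    pathSum w n (U + D) (U - D) = rowProd τ r k n v U D := by
  obtain ⟨j, hj⟩ : ∃ j, j = U + D := ⟨_, rfl⟩
  induction j generalizing U D with
  | zero =>
    obtain ⟨rfl, rfl⟩ : U = 0 ∧ D = 0 := by omega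
    have h0 := h1 n (by omega) (by omega)
    simp [pathSum_zero, rowProd, brFact, h0]
  | succ j ih =>
    rw [← hj, pathSum_succ]
    rcases Nat.eq_zero_or_pos D with rfl | hD0
    · obtain ⟨U, rfl⟩ : ∃ U', U = U' + 1 := ⟨U - 1, by omega⟩
      obtain rfl : j = U := by omega
      have e1 := ih j 0 (by omega) (by omega) rfl
      have e2 := hup j 0 (by omega) (by omega)
      have n1 := h1 (n + j) (by omega) (by omega)
      have n2 := h1 (n + j + 1) (by omega) (by omega)
      push_cast at n1 n2
      rw [pathSum_of_lt w n (x := ((j + 1 : ℕ) : ℤ) - (0 : ℕ) + 1)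
        (by rw [abs_of_pos (by omega)]; omega),
        rowProd_succ_zero n1 n2 (fun i hi => h2 i (by omega)), ← e1, ← e2, zero_mul, add_zero]
      congr 2 <;> (push_cast; ring)
    obtain ⟨D, rfl⟩ : ∃ D', D = D' + 1 := ⟨D - 1, by omega⟩
    rcases Nat.eq_zero_or_pos U with rfl | hU0
    · obtain rfl : j = D := by omega
      have e1 := ih 0 j (by omega) (by omega) (by omega)
      have e2 := hdown 0 j (by omega) (by omega)
      have n1 := h1 (n - j) (by omega) (by omega)
      have n2 := h1 (n - j - 1) (by omega) (by omega)
      push_cast at n1 n2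
      rw [pathSum_of_lt w n (x := ((0 : ℕ) : ℤ) - (j + 1 : ℕ) - 1)
        (by rw [abs_of_neg (by omega)]; omega),
        rowProd_zero_succ n1 n2 (fun i hi => h2 i (by omega)), ← e1, ← e2, zero_mul, zero_add,
        zero_add]
      congr 2 <;> (push_cast; ring)
    obtain ⟨U, rfl⟩ : ∃ U', U = U' + 1 := ⟨U - 1, by omega⟩
    have e1 := ih U (D + 1) (by omega) (by omega) (by omega)
    have e2 := hup U (D + 1) (by omega) (by omega)
    have e3 := ih (U + 1) D (by omega) (by omega) (by omega)
    have e4 := hdown (U + 1) D (by omega) (by omega)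
    rw [rowProd_succ_succ hτ ?_ (fun i hi => h2 i (by omega)) (fun i hi => h3 i (by omega)),
      ← e1, ← e2, ← e3, ← e4, show j = U + (D + 1) by omega,
      show U + 1 + D = U + (D + 1) by omega]
    · congr 3 <;> (push_cast; ring)
    · intro i hi1 hi2
      have := h1 (n + i) (by omega) (by omega)
      push_cast at this
      exact this

theorem faceKK_eq_rowProd {τ : ℂ} (hτ : 0 < τ.im) {r u : ℂ} {k : ℕ} (hk : 1 ≤ k)
    {P Q : ℤ → ℤ → Fin k → ℤˣ} (hP : IsPathChoice P) (hQ : IsPathChoice Q)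
    (hbr : ∀ j : ℤ, 1 ≤ j → j ≤ k → br τ r (j : ℂ) ≠ 0) {n : ℤ} {s : ℕ} (hs : s ≤ k)
    (hn : ∀ a : ℤ, n - s ≤ a → a ≤ n + k → br τ r (a : ℂ) ≠ 0)
    (hu : ∀ j : ℤ, 2 - (k : ℤ) ≤ j → j ≤ k → br τ r (u + j) ≠ 0) :
    faceKK τ r P Q n (n + k) (n + k - 2 * s) n u = rowProd τ r k n (u - k + 1) (k - s) s := by
  have hw : n - (n + k) ∈ weights k := mem_weights.2 ⟨k, le_rfl, by ring⟩
  have hQn : Q (n + k) n = fun _ => -1 := by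
    have := hQ _ _ hw
    rwa [show n - (n + k) = -(k : ℤ) by ring, signs_neg_self, mem_singleton] at this
  have hsum : faceKK τ r P Q n (n + k) (n + k - 2 * s) n u =
      pathSum (fun i l l' => faceK1 τ r P l (n + k - i) l' (n + k - i - 1) (u - k + 1 + i)) n
        (k - s + s) ((k - s : ℕ) - s) := by
    rw [faceKK, if_pos hw, hQn, Nat.sub_add_cancel hs, pathSum,
      show n + k - 2 * s - n = ((k - s : ℕ) : ℤ) - s by omega]
    refine sum_congr rfl fun e _ => prod_congr rfl fun i _ => ?_
    rw [height_neg_one _ i.2.le, height_neg_one _ (Nat.succ_le_of_lt i.2)]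
    congr 1
    push_cast; ring
  -- After `U` ascents and `D` descents the row runs from `n + U - D` to `n + k - (U + D)`, hence
  -- has `k - U` ascents and `U` descents. As `U + D` varies from `0` to `k - 1`, the denominators
  -- use exactly the shifts `2 - k, …, k` of `u`.
  have key : ∀ U D : ℕ, U + D < k → D ≤ s → _ := fun U D hUD hD =>
    faceK1_eq hτ r (u - k + 1 + (U + D : ℕ)) hP (n + U - D) (k - U) U (by omega) (by omega)
      (by omega) hk (fun h h1 h2 => hn h (by omega) (by omega)) (fun j h1 h2 => by
        have := hu (1 - k + (U + D : ℕ) + j) (by omega) (by omega)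
        push_cast at this ⊢
        rwa [show u - k + 1 + ((U : ℂ) + D) + j = u + (1 - k + ((U : ℂ) + D) + j) by ring])
  rw [hsum]
  refine pathSum_eq_rowProd hτ ?_ ?_ hn ?_ ?_ _ _ (by omega) le_rfl
  · intro U D hUD hD
    have h := (key U D hUD hD).2
    rw [show n + U - D + (k - U) - U = n + k - (U + D : ℕ) by push_cast; ring] at h
    rw [h, rowUp]
    push_cast
    congr 3 <;> ring
  · intro U D hUD hD
    have h := (key U D hUD hD).1
    rw [show n + U - D + (k - U) - U = n + k - (U + D : ℕ) by push_cast; ring] at h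
    rw [h, rowDown]
    push_cast
    congr 3 <;> ring
  · intro i hi
    have := hbr (i + 1) (by omega) (by omega)
    push_cast at this
    exact this
  · intro i hi
    have := hu (1 + i) (by omega) (by omega)
    push_cast at this
    rwa [show u - k + 1 + k + (i : ℂ) = u + (1 + i) by ring]

/-! ### The symbols `(a,b)_k` and the comparison of the two products. -/

theorem prod_Icc_add (f : ℤ → ℂ) (a : ℤ) (m : ℕ) :
    ∏ i ∈ Icc a (a + m), f i = ∏ i ∈ range (m + 1), f (a + i) := by
  refine prod_bij' (fun i _ => (i - a).toNat) (fun i _ => a + i) ?_ ?_ ?_ ?_ ?_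
  · intro i hi; simp at hi ⊢; omega
  · intro i hi; simp at hi ⊢; omega
  · intro i hi; simp at hi ⊢; omega
  · intro i hi; simp
  · intro i hi
    have := mem_Icc.1 hi
    congr 1; omega

theorem brFact_ne_zero {τ r : ℂ} {k : ℕ}
    (hbr : ∀ j : ℤ, 1 ≤ j → j ≤ k → br τ r (j : ℂ) ≠ 0) {m : ℕ} (hm : m ≤ k) :
    brFact τ r m ≠ 0 :=
  prod_ne_zero_iff.2 fun i hi => by
    have := mem_range.1 hi
    have := hbr (i + 1) (by omega) (by omega)
    push_cast at this
    exact this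

theorem prod_range_sub_eq_brFact (τ r : ℂ) (m : ℕ) :
    ∏ i ∈ range m, br τ r ((m : ℂ) - i) = brFact τ r m := by
  rw [brFact, ← prod_range_reflect]
  refine prod_congr rfl fun i hi => ?_
  have := mem_range.1 hi
  rw [Nat.sub_sub, Nat.cast_sub (by omega)]
  congr 1
  push_cast; ring

theorem ellBinom_eq {τ r : ℂ} {k : ℕ} (hbr : ∀ j : ℤ, 1 ≤ j → j ≤ k → br τ r (j : ℂ) ≠ 0)
    {s : ℕ} (hs : s ≤ k) :
    ellBinom τ r k s = brFact τ r k / (brFact τ r (k - s) * brFact τ r s) := by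
  have h1 := brFact_ne_zero hbr hs
  have h2 := brFact_ne_zero hbr (Nat.sub_le k s)
  rw [ellBinom, prod_range_sub_eq_brFact, ← prod_range_sub_eq_brFact τ r k,
    show range k = range (s + (k - s)) by rw [Nat.add_sub_cancel' hs], prod_range_add]
  have h3 : ∏ i ∈ range (k - s), br τ r ((k : ℂ) - (s + i : ℕ)) = brFact τ r (k - s) := by
    rw [← prod_range_sub_eq_brFact, Nat.cast_sub hs]
    refine prod_congr rfl fun i _ => ?_
    congr 1; push_cast; ring
  rw [h3]
  field_simp

theorem abSym_eq (τ r : ℂ) (g : ℤ → ℂ) (n : ℤ) {k s : ℕ} :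
    abSym τ r g k n (n + k - 2 * s) = (ellBinom τ r k s)⁻¹ *
      ((∏ i ∈ range (k + 1), br τ r ((n : ℂ) - s + i)) / (g n * g (n + k - 2 * s))) := by
  rw [abSym, show ((n - (n + k - 2 * s) + k) / 2).toNat = s by omega,
    show (n + (n + k - 2 * s) - k) / 2 = n - s by omega,
    show (n + (n + k - 2 * s) + k) / 2 = n - s + k by omega, prod_Icc_add fun i => br τ r i]
  push_cast
  rfl

theorem abSym_asc (τ r : ℂ) (g : ℤ → ℂ) (n : ℤ) (k : ℕ) :
    abSym τ r g k (n + k) (n + 2 * k) =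
      (∏ i ∈ range (k + 1), br τ r ((n : ℂ) + k + i)) / (g (n + 2 * k) * g (n + k)) := by
  rw [abSym, show ((n + k - (n + 2 * k) + k) / 2).toNat = 0 by omega,
    show (n + k + (n + 2 * k) - k) / 2 = n + k by omega,
    show (n + k + (n + 2 * k) + k) / 2 = n + k + k by omega, prod_Icc_add fun i => br τ r i,
    mul_comm (g (n + 2 * k))]
  simp [ellBinom]

/-- The binomial is trivial for `B = k` as for `B = 0`, so the value agrees with `abSym_asc`. This
exchanges `(n+2k, n+k)_k` in (a) for `(n+k, n+2k)_k` in (b). -/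
theorem abSym_desc {τ r : ℂ} {k : ℕ} (hbr : ∀ j : ℤ, 1 ≤ j → j ≤ k → br τ r (j : ℂ) ≠ 0)
    (g : ℤ → ℂ) (n : ℤ) :
    abSym τ r g k (n + 2 * k) (n + k) =
      (∏ i ∈ range (k + 1), br τ r ((n : ℂ) + k + i)) / (g (n + 2 * k) * g (n + k)) := by
  have h := brFact_ne_zero hbr le_rfl
  rw [abSym, show ((n + 2 * k - (n + k) + k) / 2).toNat = k by omega,
    show (n + 2 * k + (n + k) - k) / 2 = n + k by omega,
    show (n + 2 * k + (n + k) + k) / 2 = n + k + k by omega, prod_Icc_add fun i => br τ r i,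
    ellBinom_eq hbr le_rfl]
  simp [brFact] at h ⊢
  rw [div_self h, one_mul]

/-- The two closed forms agree once some products are reversed. The square roots `g n` and `g (n + 2
* k)` cancel, while the other two occur squared and give the factors `[n + k - 2s]` and `[n + k]`,
so their choice is immaterial. -/
theorem faceKK_eq_Lmat {τ : ℂ} (hτ : 0 < τ.im) {r u : ℂ} {k : ℕ} (hk : 1 ≤ k)
    {P Q R : ℤ → ℤ → Fin k → ℤˣ} {E : ℤ → Fin k → ℤˣ}
    (hP : IsPathChoice P) (hQ : IsPathChoice Q) (hR : IsPathChoice R) (hE : IsSignChoice E)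
    {g : ℤ → ℂ} (hg : ∀ a : ℤ, g a ^ 2 = br τ r (a : ℂ))
    (hbr : ∀ j : ℤ, 1 ≤ j → j ≤ k → br τ r (j : ℂ) ≠ 0) {n : ℤ} {s : ℕ} (hs : s ≤ k)
    (hn : ∀ a : ℤ, n - s ≤ a → a ≤ n + 2 * k → br τ r (a : ℂ) ≠ 0)
    (hu : ∀ j : ℤ, 2 - (k : ℤ) ≤ j → j ≤ k → br τ r (u + j) ≠ 0) :
    faceKK τ r P Q n (n + k) (n + k - 2 * s) n u =
      (-1) ^ (k - s) * (g (n + k - 2 * s) * g (n + 2 * k) / (g (n + k) * g n)) *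
        (abSym τ r g k (n + 2 * k) (n + k) / abSym τ r g k n (n + k - 2 * s)) *
        Lmat τ r R E n (n + k - 2 * s) (n + 2 * k) (n + k) (u + 1) := by
  have hg0 : ∀ a : ℤ, n - s ≤ a → a ≤ n + 2 * k → g a ≠ 0 := fun a h1 h2 h3 =>
    hn a h1 h2 (by rw [← hg, h3]; ring)
  have g0 := hg0 n (by omega) (by omega)
  have g1 := hg0 (n + k - 2 * s) (by omega) (by omega)
  have g2 := hg0 (n + 2 * k) (by omega) (by omega)
  have g3 := hg0 (n + k) (by omega) (by omega)
  have sq1 := hg (n + k - 2 * s)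
  have sq3 := hg (n + k)
  have b3 := hn (n + k) (by omega) (by omega)
  have f1 := brFact_ne_zero hbr le_rfl
  have f2 := brFact_ne_zero hbr hs
  have f3 := brFact_ne_zero hbr (Nat.sub_le k s)
  rw [faceKK_eq_rowProd hτ hk hP hQ hbr hs (fun a h1 h2 => hn a h1 (by omega)) hu,
    Lmat_eq_prod hτ r u hR hE n hs, abSym_eq, abSym_desc hbr, ellBinom_eq hbr hs, rowProd]
  simp only [prod_mul_distrib]
  have hks : ((k - s : ℕ) : ℂ) = k - s := Nat.cast_sub hs
  have p1 : ∏ i ∈ range (k - s), br τ r (n - s - (u - k + 1) - i) =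
      ∏ p ∈ range (k - s), br τ r (n + p - u) := by
    rw [← prod_range_reflect]
    refine prod_congr rfl fun i hi => ?_
    have := mem_range.1 hi
    rw [Nat.sub_sub, Nat.cast_sub (by omega), hks]
    congr 1; push_cast; ring
  -- Oddness of the elliptic number produces `(-1) ^ s`; with the `(-1) ^ k` of `Lmat_eq_prod` it
  -- gives the sign `(-1) ^ (k - s)`.
  have p2 : ∏ i ∈ range s, br τ r (u - k + 1 + (k - s : ℕ) + i) =
      (-1) ^ s * ∏ m ∈ range s, br τ r (m - u) := by
    rw [← prod_range_reflect, ← card_range s, ← prod_const, card_range, ← prod_mul_distrib]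
    refine prod_congr rfl fun i hi => ?_
    have := mem_range.1 hi
    rw [hks, Nat.sub_sub, Nat.cast_sub (by omega), neg_one_mul, ← br_neg]
    congr 1; push_cast; ring
  have p3 : ∏ i ∈ range (k - s + s), br τ r (u - k + 1 + k + i) =
      ∏ i ∈ range k, br τ r (u + k - i) := by
    rw [Nat.sub_add_cancel hs, ← prod_range_reflect]
    refine prod_congr rfl fun i hi => ?_
    have := mem_range.1 hi
    rw [Nat.sub_sub, Nat.cast_sub (by omega)]
    congr 1; push_cast; ring
  have p4 : ∏ i ∈ range (k + 1), br τ r ((n : ℂ) + k + i) =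
      (∏ i ∈ range k, br τ r (n + 2 * k - i)) * br τ r (n + k) := by
    rw [prod_range_succ', ← prod_range_reflect]
    congr 1
    · refine prod_congr rfl fun i hi => ?_
      have := mem_range.1 hi
      rw [Nat.sub_sub, show k - (1 + i) + 1 = k - i by omega, Nat.cast_sub (by omega)]
      congr 1; ring
    · simp
  have c1 : ∏ i ∈ range k, br τ r (u + k - i) ≠ 0 := prod_ne_zero_iff.2 fun i hi => by
    have := mem_range.1 hi
    have := hu (k - i) (by omega) (by omega)
    push_cast at this
    rwa [show u + (k : ℂ) - i = u + (k - i) by ring]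
  have c2 : ∏ i ∈ range k, br τ r (n + 2 * k - i) ≠ 0 := prod_ne_zero_iff.2 fun i hi => by
    have := mem_range.1 hi
    have := hn (n + 2 * k - i) (by omega) (by omega)
    push_cast at this
    exact this
  have c3 : ∏ i ∈ range (k + 1), br τ r ((n : ℂ) - s + i) ≠ 0 := prod_ne_zero_iff.2 fun i hi => by
    have := mem_range.1 hi
    have := hn (n - s + i) (by omega) (by omega)
    push_cast at this
    exact this
  have hsgn : (-1 : ℂ) ^ k = (-1) ^ (k - s) * (-1) ^ s := by
    rw [← pow_add, Nat.sub_add_cancel hs]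
  have hsgn2 : ((-1 : ℂ) ^ (k - s)) * (-1) ^ (k - s) = 1 := by
    rw [← mul_pow]; norm_num
  rw [p1, p2, p3, p4, hsgn, Nat.sub_add_cancel hs, hks]
  push_cast at sq1 sq3 b3
  rw [show (n : ℂ) + (k - s) - s = n + k - 2 * s by ring, ← sq1, ← sq3]
  generalize (∏ i ∈ range k, br τ r (u + k - i)) = A1 at *
  generalize (∏ i ∈ range k, br τ r (n + 2 * k - i)) = A2 at *
  generalize (∏ i ∈ range (k + 1), br τ r ((n : ℂ) - s + i)) = A3 at *
  generalize (∏ p ∈ range (k - s), br τ r (n + p - u)) = A4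
  generalize (∏ m ∈ range s, br τ r (m - u)) = A5
  generalize (∏ m ∈ range s, br τ r (n + k - m)) = A6
  generalize (∏ p ∈ range (k - s), br τ r (k - p)) = A7
  generalize (-1 : ℂ) ^ (k - s) = S1 at *
  generalize (-1 : ℂ) ^ s = S2 at *
  field_simp
  linear_combination (-A7 * A4 * A6 * S2 * A5) * hsgn2

/-! ### The integrands -/

theorem abSym_asc_ne_zero {τ r : ℂ} {k : ℕ} {n : ℤ}
    (hn : ∀ a : ℤ, n + k ≤ a → a ≤ n + 2 * k → br τ r (a : ℂ) ≠ 0) {g : ℤ → ℂ}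
    (hg : ∀ a : ℤ, g a ^ 2 = br τ r (a : ℂ)) : abSym τ r g k (n + k) (n + 2 * k) ≠ 0 := by
  have hg0 : ∀ a : ℤ, n + k ≤ a → a ≤ n + 2 * k → g a ≠ 0 := fun a h1 h2 h3 =>
    hn a h1 h2 (by rw [← hg, h3]; ring)
  rw [abSym_asc]
  refine div_ne_zero (prod_ne_zero_iff.2 fun i hi => ?_)
    (mul_ne_zero (hg0 _ (by omega) le_rfl) (hg0 _ le_rfl (by omega)))
  have := mem_range.1 hi
  have := hn (n + k + i) (by omega) (by omega)
  push_cast at this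
  exact this

theorem IPhi_eq_ILambda {τ : ℂ} (hτ : 0 < τ.im) {r : ℂ} {k : ℕ} (hk : 1 ≤ k)
    {P Q R : ℤ → ℤ → Fin k → ℤˣ} {E : ℤ → Fin k → ℤˣ}
    (hP : IsPathChoice P) (hQ : IsPathChoice Q) (hR : IsPathChoice R) (hE : IsSignChoice E)
    {g : ℤ → ℂ} (hg : ∀ a : ℤ, g a ^ 2 = br τ r (a : ℂ))
    (hbr : ∀ j : ℤ, 1 ≤ j → j ≤ k → br τ r (j : ℂ) ≠ 0) {n : ℤ}
    (hn : ∀ a : ℤ, n - k ≤ a → a ≤ n + 2 * k → br τ r (a : ℂ) ≠ 0) {u₁ u₂ : ℂ}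
    (hu : ∀ j : ℤ, 2 - (k : ℤ) ≤ j → j ≤ k → br τ r (u₁ - u₂ + j) ≠ 0) {v : Fin k → ℂ}
    (hv : v ∈ generic τ r k u₁ u₂) :
    IPhi τ r P Q n u₁ u₂ v =
      (-1) ^ k * (g (n + 2 * k) / g n) * abSym τ r g k (n + k) (n + 2 * k) *
        ILambda τ r g R E n u₁ (-u₂) v *
        ∏ j : Fin k, br τ r (u₂ - v j - k / 2) / br τ r (u₂ - v j + k / 2) := by
  have hg0 : ∀ a : ℤ, n - k ≤ a → a ≤ n + 2 * k → g a ≠ 0 := fun a h1 h2 h3 =>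
    hn a h1 h2 (by rw [← hg, h3]; ring)
  have g0 := hg0 n (by omega) (by omega)
  have g2 := hg0 (n + 2 * k) (by omega) (by omega)
  have ab0 := abSym_asc_ne_zero (fun a h1 h2 => hn a (by omega) h2) hg
  -- This trades the denominators of `IPhi` for those of `ILambda`. In the `s`-th summand the
  -- factors with `j < k - s` already show the ratio; the others acquire it here, which completes
  -- the product over all `j`.
  have hcancel : ∀ (j : Fin k) (x : ℂ), x / br τ r (u₂ - v j + k / 2) =
      x / br τ r (u₂ - v j - k / 2) * (br τ r (u₂ - v j - k / 2) / br τ r (u₂ - v j + k / 2)) :=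
    fun j x => by rw [div_mul_div_cancel₀ (hv.1 j).2.2]
  have hsgn : (-1 : ℂ) ^ k * (-1) ^ k = 1 := by rw [← mul_pow]; norm_num
  rw [IPhi, ILambda, mul_sub, sub_mul, neg_neg]
  congr 1
  · rw [prod_congr rfl fun j _ => hcancel j _, prod_mul_distrib]
    generalize (∏ j, br τ r (u₁ - v j - k / 2) / br τ r (u₁ - v j + k / 2)) = A1
    generalize (∏ j : Fin k, br τ r (u₂ - v j + n - k / 2 + 2 * ((j : ℕ) + 1) - 1) /
      br τ r (u₂ - v j - k / 2)) = A2
    generalize (∏ j, br τ r (u₂ - v j - k / 2) / br τ r (u₂ - v j + k / 2)) = A3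
    generalize (-1 : ℂ) ^ k = S at *
    field_simp
    linear_combination (-A1 * A2 * A3) * hsgn
  · rw [mul_sum, sum_mul]
    refine sum_congr rfl fun s hs => ?_
    have hsk : s ≤ k := Nat.lt_succ_iff.1 (mem_range.1 hs)
    have hface := faceKK_eq_Lmat hτ hk hP hQ hR hE hg hbr hsk
      (fun a h1 h2 => hn a (by omega) h2) hu
    have hsplit : ∏ j : Fin k, br τ r (u₂ - v j - k / 2) / br τ r (u₂ - v j + k / 2) =
        (∏ j : Fin k with j.val < k - s, br τ r (u₂ - v j - k / 2) / br τ r (u₂ - v j + k / 2)) *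
        ∏ j : Fin k with k - s ≤ j.val,
          br τ r (u₂ - v j - k / 2) / br τ r (u₂ - v j + k / 2) := by
      rw [← prod_filter_mul_prod_filter_not univ fun j : Fin k => j.val < k - s]
      simp only [not_lt]
    have hlast : ∏ j : Fin k with k - s ≤ j.val,
          br τ r (u₂ - v j + n - 3 * k / 2 + 2 * ((j : ℕ) + 1) - 1) / br τ r (u₂ - v j + k / 2) =
        (∏ j : Fin k with k - s ≤ j.val,
          br τ r (u₂ - v j + n - 3 * k / 2 + 2 * ((j : ℕ) + 1) - 1) /
            br τ r (u₂ - v j - k / 2)) *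
        ∏ j : Fin k with k - s ≤ j.val,
          br τ r (u₂ - v j - k / 2) / br τ r (u₂ - v j + k / 2) := by
      rw [← prod_mul_distrib]
      exact prod_congr rfl fun j _ => hcancel j _
    have hpow : (-1 : ℂ) ^ (k - s) = (-1) ^ k * (-1) ^ s := by
      have : (-1 : ℂ) ^ k = (-1) ^ (k - s) * (-1) ^ s := by
        rw [← pow_add, Nat.sub_add_cancel hsk]
      rw [this, mul_assoc, ← mul_pow]
      norm_num
    rw [hface, hsplit, hlast, abSym_desc hbr, ← abSym_asc, hpow,
      show u₁ + -u₂ + 1 = u₁ - u₂ + 1 by ring]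
    ring

/-- The relation between the integrands holds only at generic points, but the symmetrisation
evaluates them at every permutation of `v`. -/
theorem comp_mem_generic {τ r u₁ u₂ : ℂ} {k : ℕ} {v : Fin k → ℂ} (hv : v ∈ generic τ r k u₁ u₂)
    (σ : Equiv.Perm (Fin k)) : (fun i => v (σ i)) ∈ generic τ r k u₁ u₂ :=
  ⟨fun j => hv.1 (σ j), fun _ _ hij => hv.2 _ _ fun h => hij (σ.injective h)⟩

/-- Weak equality to zero is not affected by a nonvanishing symmetric factor. -/
theorem weaklyZero_iff_of_eq_mul {τ r : ℂ} {k : ℕ} {G : Set (Fin k → ℂ)}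
    (hG : ∀ v ∈ G, ∀ σ : Equiv.Perm (Fin k), (fun i => v (σ i)) ∈ G)
    {f h φ : (Fin k → ℂ) → ℂ} (hφ : ∀ v ∈ G, φ v ≠ 0)
    (hsymm : ∀ v (σ : Equiv.Perm (Fin k)), φ (fun i => v (σ i)) = φ v)
    (hf : ∀ v ∈ G, f v = φ v * h v) : WeaklyZero τ r G h ↔ WeaklyZero τ r G f := by
  refine forall₂_congr fun v hv => ?_
  rw [← mul_eq_zero_iff_left (hφ v hv), mul_sum]
  refine Eq.congr_left (sum_congr rfl fun σ _ => ?_)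
  rw [hf _ (hG v hv σ), hsymm]
  ring

end FusionSOS

end

open FusionSOS
theorem mainTheorem4 (τ r : ℂ) (hτ : 0 < τ.im) (hr : r ≠ 0) (k : ℕ) (hk : 1 ≤ k)
    -- choices of the intermediate variables of which the fused objects are independent
    (P Q R : ℤ → ℤ → Fin k → ℤˣ) (E : ℤ → Fin k → ℤˣ)
    (hP : IsPathChoice P) (hQ : IsPathChoice Q) (hR : IsPathChoice R) (hE : IsSignChoice E)
    -- square roots of the numbers `[a]`
    (g : ℤ → ℂ) (hg : ∀ a : ℤ, g a ^ 2 = br τ r (a : ℂ))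
    (hbr : ∀ j : ℤ, 1 ≤ j → j ≤ k → br τ r (j : ℂ) ≠ 0) (n : ℤ) :
    (∀ s : ℕ, s ≤ k → (∀ a : ℤ, n - s ≤ a → a ≤ n + 2 * k → br τ r (a : ℂ) ≠ 0) →
      ∀ u : ℂ, (∀ j : ℤ, 2 - (k : ℤ) ≤ j → j ≤ k → br τ r (u + j) ≠ 0) →
        faceKK τ r P Q n (n + k) (n + k - 2 * s) n u =
          (-1) ^ (k - s) * (g (n + k - 2 * s) * g (n + 2 * k) / (g (n + k) * g n)) *
            (abSym τ r g k (n + 2 * k) (n + k) / abSym τ r g k n (n + k - 2 * s)) *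
            Lmat τ r R E n (n + k - 2 * s) (n + 2 * k) (n + k) (u + 1)) ∧
    ((∀ a : ℤ, n - k ≤ a → a ≤ n + 2 * k → br τ r (a : ℂ) ≠ 0) →
      ∀ u₁ u₂ : ℂ, (∀ j : ℤ, 2 - (k : ℤ) ≤ j → j ≤ k → br τ r (u₁ - u₂ + j) ≠ 0) →
        (∀ v ∈ generic τ r k u₁ u₂,
          IPhi τ r P Q n u₁ u₂ v =
            (-1) ^ k * (g (n + 2 * k) / g n) * abSym τ r g k (n + k) (n + 2 * k) *
              ILambda τ r g R E n u₁ (-u₂) v *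
              ∏ j : Fin k, br τ r (u₂ - v j - k / 2) / br τ r (u₂ - v j + k / 2)) ∧
        (WeaklyZero τ r (generic τ r k u₁ u₂) (ILambda τ r g R E n u₁ (-u₂)) ↔
          WeaklyZero τ r (generic τ r k u₁ u₂) (IPhi τ r P Q n u₁ u₂))) := by
  refine ⟨fun s hs hn u hu => faceKK_eq_Lmat hτ hk hP hQ hR hE hg hbr hs hn hu,
    fun hn u₁ u₂ hu => ?_⟩
  have hmain := fun v hv =>
    IPhi_eq_ILambda (v := v) hτ hk hP hQ hR hE hg hbr hn hu hv
  -- The factor depends on `v` only through a product over all `j`, so it is symmetric; genericity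
  -- makes the numerators and denominators of that product nonzero.
  refine ⟨hmain, weaklyZero_iff_of_eq_mul (φ := fun v =>
    (-1) ^ k * (g (n + 2 * k) / g n) * abSym τ r g k (n + k) (n + 2 * k) *
      ∏ j : Fin k, br τ r (u₂ - v j - k / 2) / br τ r (u₂ - v j + k / 2))
    (fun v hv σ => comp_mem_generic hv σ) (fun v hv => ?_) (fun v σ => ?_) fun v hv => ?_⟩
  · have hg0 : ∀ a : ℤ, n - k ≤ a → a ≤ n + 2 * k → g a ≠ 0 := fun a h1 h2 h3 =>
      hn a h1 h2 (by rw [← hg, h3]; ring)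
    exact mul_ne_zero (mul_ne_zero (mul_ne_zero (pow_ne_zero _ (by norm_num))
      (div_ne_zero (hg0 _ (by omega) (by omega)) (hg0 _ (by omega) (by omega))))
      (abSym_asc_ne_zero (fun a h1 h2 => hn a (by omega) h2) hg))
      (Finset.prod_ne_zero_iff.2 fun j _ => div_ne_zero (hv.1 j).2.2 (hv.1 j).2.1)
  · dsimp only
    rw [Equiv.prod_comp σ fun j => br τ r (u₂ - v j - k / 2) / br τ r (u₂ - v j + k / 2)]
  · rw [hmain v hv]
    ring
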